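/- Let $\mathbb{K}$ be an algebraically closed field, let $p$ be an odd positive integer, and let $q\in\mathbb{K}^*$ be not a root of unity. Let $A$ be the quantum torus over $\mathbb{K}$ with generators $z_1^{\pm1},\dots,z_p^{\pm1}$ and relations $z_iz_j=q_{ij}z_jz_i$ for $1\le j<i\le p$, where $q_{ij}=q^{-1}$ if $i$ is even and $j$ is odd, and $q_{ij}=1$ otherwise; $z_p$ is central in $A$. Let $\alpha$ be the $\mathbb{K}$-automorphism of $A$ with $\alpha(z_i)=z_i$ for $i$ even and $\alpha(z_i)=q^{-1}z_i$ for $i$ odd. Put $$u=q^{\frac{p-1}{2}}z_p^{-1}+qz_p,\qquad v=u-\alpha(u)=(1-q)\bigl(q^{\frac{p-1}{2}}z_p^{-1}-z_p\bigr).$$ Let $R=R(A,\alpha,v,1)=A[y;\alpha][x;\beta,\delta]$ be the ambiskew polynomial algebra, where $\beta=\alpha^{-1}$ is extended to $A[y;\alpha]$ by $\beta(y)=y$, and $\delta$ is the $\beta$-derivation of $A[y;\alpha]$ with $\delta(A)=0$ and $\delta(y)=v$; thus $ya=\alpha(a)y$ and $xa=\alpha^{-1}(a)x$ for $a\in A$,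 and $xy=yx+v$. Let $z=xy-u$, a central element of $R$. Fix a fourth root $q^{1/4}$ of $q$ in $\mathbb{K}$ and write $q^{k/4}=(q^{1/4})^k$ for $k\in\mathbb{Z}$. Then the following hold. (1) For every $\lambda\in\mathbb{K}$, the ideal $(z-\lambda)R$ is a maximal (two-sided) ideal of $R$ if and only if $\lambda\ne\pm q^{\frac{p-2m+1}{4}}(q^m+1)$ for all integers $m\ge1$. (2) For every $\lambda\in\mathbb{K}$ and every integer $m\ge1$, the ideal $(u+\lambda)A+\alpha^m(u+\lambda)A$ of $A$ is proper if and only if $\lambda=q^{\frac{p-2m+1}{4}}(q^m+1)$ or $\lambda=-q^{\frac{p-2m+1}{4}}(q^m+1)$. (3) If $m\ge1$ and $\lambda=\pm q^{\frac{p-2m+1}{4}}(q^m+1)$ (either sign), then $(u+\lambda)A+\alpha^m(u+\lambda)A$ is a maximal ideal of $A$ and is completely prime (the factor ring is a domain), and $(u+\lambda)A+\alpha^a(u+\lambda)A=A$ for every integer $a\ge1$ with $a\ne m$. -/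

import Mathlib

namespace Ambiskew

noncomputable section

/-! ## Ore extensions `S[x; σ, δ]` -/

/-- A (left) `σ`-derivation of a ring `S`: an additive map `δ` with
`δ (a * b) = σ a * δ b + δ a * b`. -/
structure SkewDerivation {S : Type*} [Ring S] (σ : S →+* S) where
  toAddHom : S →+ S
  leibniz : ∀ a b : S, toAddHom (a * b) = σ a * toAddHom b + toAddHom a * b

/-- The zero `σ`-derivation. -/
def SkewDerivation.zero {S : Type*} [Ring S] (σ : S →+* S) : SkewDerivation σ where
  toAddHom := 0
  leibniz a b := by simp

/-- The skew polynomial ring (Ore extension) `S[x; σ, δ]`: finite sums `∑ sₙ xⁿ` with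
coefficients on the left (`Finsupp.single n s` is `s xⁿ`), and multiplication determined by
`x s = σ(s) x + δ(s)`. -/
def OreExtension {S : Type*} [Ring S] (σ : S →+* S) (_δ : SkewDerivation σ) : Type _ :=
  ℕ →₀ S

namespace OreExtension

variable {S : Type*} [Ring S] {σ : S →+* S} {δ : SkewDerivation σ}

instance : AddCommGroup (OreExtension σ δ) := inferInstanceAs (AddCommGroup (ℕ →₀ S))

/-- The monomial `s xⁿ`, additive in `s`. -/
def monomial (n : ℕ) : S →+ OreExtension σ δ := Finsupp.singleAddHom n

/-- Additive maps out of `S[x; σ, δ]` are determined by their values on the monomials `s xⁿ`. -/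
def liftAdd {M : Type*} [AddCommMonoid M] (f : ℕ → S →+ M) : OreExtension σ δ →+ M :=
  Finsupp.liftAddHom f

theorem liftAdd_monomial {M : Type*} [AddCommMonoid M] (f : ℕ → S →+ M) (n : ℕ) (s : S) :
    liftAdd (σ := σ) (δ := δ) f (monomial n s) = f n s :=
  Finsupp.liftAddHom_apply_single f n s

theorem addHom_ext' {M : Type*} [AddZeroClass M] {f g : OreExtension σ δ →+ M}
    (h : ∀ n s, f (monomial n s) = g (monomial n s)) : f = g :=
  Finsupp.addHom_ext h

theorem end_ext {f g : AddMonoid.End (OreExtension σ δ)}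
    (h : ∀ n s, f (monomial n s) = g (monomial n s)) : f = g :=
  Finsupp.addHom_ext h

theorem end_mul_apply (f g : AddMonoid.End (OreExtension σ δ)) (h : OreExtension σ δ) :
    (f * g) h = f (g h) := rfl

theorem end_add_apply (f g : AddMonoid.End (OreExtension σ δ)) (h : OreExtension σ δ) :
    (f + g) h = f h + g h := rfl

/-- Induction on elements of `S[x; σ, δ]`. -/
theorem induction {P : OreExtension σ δ → Prop} (f : OreExtension σ δ) (zero : P 0)
    (add : ∀ f g, P f → P g → P (f + g)) (monomial : ∀ n s, P (monomial n s)) : P f :=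
  Finsupp.induction_linear f zero add monomial

/-- Left multiplication by a coefficient: `s · (t xⁿ) = (s t) xⁿ`. -/
def coeffMul : S →+ AddMonoid.End (OreExtension σ δ) where
  toFun s := liftAdd fun n => (monomial n).comp (AddMonoidHom.mulLeft s)
  map_zero' := by
    refine end_ext fun n s => (liftAdd_monomial _ n s).trans ?_
    change monomial n (0 * s) = 0
    rw [zero_mul, map_zero]
  map_add' a b := by
    refine end_ext fun n s => ?_
    refine (liftAdd_monomial _ n s).trans ?_
    have h : ∀ c : S, (liftAdd fun n => (monomial n).comp (AddMonoidHom.mulLeft c) :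
        OreExtension σ δ →+ OreExtension σ δ) (monomial n s) = monomial n (c * s) :=
      fun c => liftAdd_monomial _ n s
    refine Eq.trans ?_ (congrArg₂ (· + ·) (h a) (h b)).symm
    change monomial n ((a + b) * s) = monomial n (a * s) + monomial n (b * s)
    rw [add_mul, map_add]

/-- Left multiplication by `x`: `x · (s xⁿ) = σ(s) xⁿ⁺¹ + δ(s) xⁿ`. -/
def varMul : AddMonoid.End (OreExtension σ δ) :=
  liftAdd fun n => (monomial (n + 1)).comp σ.toAddMonoidHom + (monomial n).comp δ.toAddHom

/-- Left multiplication: `∑ sₙ xⁿ` acts as `∑ sₙ · (x ·)ⁿ`. -/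
def mulHom : OreExtension σ δ →+ AddMonoid.End (OreExtension σ δ) :=
  liftAdd fun n => (AddMonoidHom.mulRight (varMul ^ n)).comp coeffMul

theorem coeffMul_monomial (s t : S) (n : ℕ) :
    coeffMul s (monomial n t : OreExtension σ δ) = monomial n (s * t) :=
  liftAdd_monomial _ n t

theorem varMul_monomial (t : S) (n : ℕ) :
    varMul (monomial n t : OreExtension σ δ)
      = monomial (n + 1) (σ t) + monomial n (δ.toAddHom t) :=
  liftAdd_monomial _ n t

theorem mulHom_monomial (s : S) (n : ℕ) :
    mulHom (monomial n s : OreExtension σ δ) = coeffMul s * varMul ^ n :=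
  liftAdd_monomial _ n s

theorem varMul_coeffMul (s : S) :
    (varMul * coeffMul s : AddMonoid.End (OreExtension σ δ))
      = coeffMul (σ s) * varMul + coeffMul (δ.toAddHom s) := by
  refine end_ext fun n t => ?_
  simp only [end_add_apply, end_mul_apply, coeffMul_monomial, varMul_monomial, map_mul, map_add,
    δ.leibniz]
  abel

theorem coeffMul_mul (s t : S) :
    (coeffMul (s * t) : AddMonoid.End (OreExtension σ δ)) = coeffMul s * coeffMul t := by
  refine end_ext fun n r => ?_
  simp only [end_mul_apply, coeffMul_monomial, mul_assoc]

theorem coeffMul_one : (coeffMul 1 : AddMonoid.End (OreExtension σ δ)) = 1 := by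
  refine end_ext fun n r => ?_
  simp [coeffMul_monomial]

theorem mulHom_coeffMul (s : S) (g : OreExtension σ δ) :
    mulHom (coeffMul s g) = coeffMul s * mulHom g := by
  induction g using OreExtension.induction with
  | zero => simp only [map_zero, mul_zero]
  | add f g hf hg => simp only [map_add, mul_add, hf, hg]
  | monomial n t => simp only [coeffMul_monomial, mulHom_monomial, coeffMul_mul, mul_assoc]

theorem mulHom_varMul (g : OreExtension σ δ) :
    mulHom (varMul g) = varMul * mulHom g := by
  induction g using OreExtension.induction with
  | zero => simp only [map_zero, mul_zero]
  | add f g hf hg => simp only [map_add, mul_add, hf, hg]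
  | monomial n t =>
    simp only [varMul_monomial, map_add, mulHom_monomial, ← mul_assoc, varMul_coeffMul, add_mul]
    simp only [mul_assoc, pow_succ']

theorem mulHom_varMul_pow (k : ℕ) (g : OreExtension σ δ) :
    mulHom ((varMul ^ k) g) = varMul ^ k * mulHom g := by
  induction k with
  | zero => simp
  | succ k ih => rw [pow_succ', end_mul_apply, mulHom_varMul, ih, mul_assoc]

theorem mulHom_mulHom (f g : OreExtension σ δ) :
    mulHom (mulHom f g) = mulHom f * mulHom g := by
  induction f using OreExtension.induction with
  | zero => rw [map_zero, zero_mul]; exact map_zero mulHom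
  | add f f' hf hf' => rw [map_add, end_add_apply, map_add, hf, hf', add_mul]
  | monomial n t =>
    rw [mulHom_monomial, end_mul_apply, mulHom_coeffMul, mulHom_varMul_pow, mul_assoc]

theorem varMul_pow_one (n : ℕ) :
    (varMul ^ n) (monomial 0 1 : OreExtension σ δ) = monomial n 1 := by
  have h1 : δ.toAddHom 1 = 0 := by simpa using δ.leibniz 1 1
  induction n with
  | zero => simp
  | succ k ih => rw [pow_succ', end_mul_apply, ih, varMul_monomial]; simp [h1]

theorem mulHom_apply_one (f : OreExtension σ δ) : mulHom f (monomial 0 1) = f := by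
  induction f using OreExtension.induction with
  | zero => rw [map_zero]; rfl
  | add f f' hf hf' => rw [map_add, end_add_apply, hf, hf']
  | monomial n t => rw [mulHom_monomial, end_mul_apply, varMul_pow_one, coeffMul_monomial, mul_one]

instance : Ring (OreExtension σ δ) where
  __ := (inferInstance : AddCommGroup (OreExtension σ δ))
  mul f g := mulHom f g
  one := monomial 0 1
  left_distrib f g h := map_add (mulHom f) g h
  right_distrib f g h := by
    change mulHom (f + g) h = mulHom f h + mulHom g h
    rw [map_add, end_add_apply]
  zero_mul f := by
    change mulHom 0 f = 0
    rw [map_zero]; rfl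
  mul_zero f := map_zero (mulHom f)
  mul_assoc f g h := by
    change mulHom (mulHom f g) h = mulHom f (mulHom g h)
    rw [mulHom_mulHom]; rfl
  one_mul f := by
    change mulHom (monomial 0 1) f = f
    rw [mulHom_monomial, coeffMul_one]; simp
  mul_one f := mulHom_apply_one f

theorem mul_def (f g : OreExtension σ δ) : f * g = mulHom f g := rfl

theorem one_def : (1 : OreExtension σ δ) = monomial 0 1 := rfl

theorem monomial_mul_monomial_zero_left (s t : S) (n : ℕ) :
    (monomial 0 s * monomial n t : OreExtension σ δ) = monomial n (s * t) := by
  simp [mul_def, mulHom_monomial, coeffMul_monomial]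

/-- The inclusion of the coefficient ring. -/
def C : S →+* OreExtension σ δ where
  toFun := monomial 0
  map_one' := rfl
  map_zero' := map_zero _
  map_add' := map_add _
  map_mul' s t := (monomial_mul_monomial_zero_left s t 0).symm

/-- The indeterminate. -/
def X : OreExtension σ δ := monomial 1 1

theorem C_apply (s : S) : (C s : OreExtension σ δ) = monomial 0 s := rfl

theorem X_mul (f : OreExtension σ δ) : X * f = varMul f := by
  rw [mul_def, X, mulHom_monomial, coeffMul_one]; simp

theorem X_mul_C (s : S) :
    (X * C s : OreExtension σ δ) = C (σ s) * X + C (δ.toAddHom s) := by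
  rw [X_mul, C_apply, varMul_monomial, C_apply, C_apply, X, monomial_mul_monomial_zero_left,
    mul_one]

theorem monomial_eq (n : ℕ) (s : S) : (monomial n s : OreExtension σ δ) = C s * X ^ n := by
  have h : ∀ n : ℕ, (X ^ n : OreExtension σ δ) = monomial n 1 := by
    intro n
    induction n with
    | zero => rfl
    | succ k ih =>
      rw [pow_succ', X_mul, ih, ← varMul_pow_one k, ← end_mul_apply, ← pow_succ',
        varMul_pow_one]
  rw [h, C_apply, monomial_mul_monomial_zero_left, mul_one]

theorem mem_center {c : OreExtension σ δ} (hC : ∀ s, C s * c = c * C s) (hX : X * c = c * X) :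
    c ∈ Subring.center (OreExtension σ δ) := by
  rw [Subring.mem_center_iff]
  intro g
  suffices h : AddMonoidHom.mulRight c = AddMonoidHom.mulLeft c from DFunLike.congr_fun h g
  refine addHom_ext' fun n s => ?_
  have h1 : Commute (C s) c := hC s
  have h2 : Commute X c := hX
  simp only [AddMonoidHom.coe_mulLeft, AddMonoidHom.mulRight_apply, monomial_eq]
  exact (h1.mul_left (h2.pow_left n)).eq

end OreExtension

/-! ## Ambiskew polynomial algebras `R(A, α, v, 1)` -/

section Ambiskew

variable {K A : Type*} [Field K] [Ring A] [Algebra K A]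

/-- The skew polynomial ring `A[y; α]`, in which `y a = α(a) y`. -/
abbrev SkewPoly (α : A ≃ₐ[K] A) : Type _ :=
  OreExtension (α : A →+* A) (SkewDerivation.zero (α : A →+* A))

open OreExtension

theorem skewPoly_varMul_pow (α : A ≃ₐ[K] A) (n m : ℕ) (b : A) :
    (varMul ^ n) (monomial m b : SkewPoly α) = monomial (n + m) ((α ^ n) b) := by
  induction n generalizing m b with
  | zero => simp
  | succ k ih =>
    rw [pow_succ', end_mul_apply, ih, varMul_monomial, pow_succ']
    change monomial (k + m + 1) (α ((α ^ k) b)) + monomial (k + m) 0 = _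
    rw [map_zero, add_zero, add_right_comm]
    rfl

theorem skewPoly_mul (α : A ≃ₐ[K] A) (n m : ℕ) (a b : A) :
    (monomial n a * monomial m b : SkewPoly α) = monomial (n + m) (a * (α ^ n) b) := by
  rw [OreExtension.mul_def, mulHom_monomial, end_mul_apply, skewPoly_varMul_pow,
    coeffMul_monomial]

/-- The extension of `β = α⁻¹` to `A[y; α]` with `β(y) = y`: it sends `a yⁿ` to `β(a) yⁿ`. -/
def betaExt (α : A ≃ₐ[K] A) : SkewPoly α →+* SkewPoly α :=
  { (liftAdd fun n => (monomial n).comp (α.symm : A →+* A).toAddMonoidHom :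
      SkewPoly α →+ SkewPoly α) with
    map_one' := by
      change liftAdd _ (monomial 0 1) = monomial 0 1
      simp [liftAdd_monomial]
    map_mul' := by
      intro f g
      let F : SkewPoly α →+ SkewPoly α :=
        liftAdd fun n => (monomial n).comp (α.symm : A →+* A).toAddMonoidHom
      have hF : ∀ n a, F (monomial n a) = monomial n (α.symm a) :=
        fun n a => liftAdd_monomial _ n a
      change F (f * g) = F f * F g
      suffices h : (AddMonoidHom.mul.compr₂ F : SkewPoly α →+ SkewPoly α →+ SkewPoly α)
          = (AddMonoidHom.mul.comp F).compl₂ F from DFunLike.congr_fun (DFunLike.congr_fun h f) g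
      refine addHom_ext' fun n a => addHom_ext' fun m b => ?_
      simp only [AddMonoidHom.compr₂_apply, AddMonoidHom.mul_apply, AddMonoidHom.compl₂_apply,
        AddMonoidHom.comp_apply, hF, skewPoly_mul, map_mul]
      congr 2
      have hc : α.symm * α ^ n = α ^ n * α.symm :=
        ((Commute.refl α).inv_left.pow_right n).eq
      exact DFunLike.congr_fun hc b }

theorem betaExt_monomial (α : A ≃ₐ[K] A) (n : ℕ) (a : A) :
    betaExt α (monomial n a) = monomial n (α.symm a) :=
  liftAdd_monomial _ n a

/-- `v⁽ⁿ⁾ = ∑_{l < n} α^l(v)`. -/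
def vSum (α : A ≃ₐ[K] A) (v : A) (n : ℕ) : A := ∑ l ∈ Finset.range n, (α ^ l) v

theorem vSum_add (α : A ≃ₐ[K] A) (v : A) (n m : ℕ) :
    vSum α v (n + m) = vSum α v n + (α ^ n) (vSum α v m) := by
  simp only [vSum, Finset.sum_range_add, pow_add, map_sum, AlgEquiv.mul_apply]

theorem apply_mem_center (α : A ≃ₐ[K] A) {v : A} (hv : v ∈ Subalgebra.center K A) :
    α v ∈ Subalgebra.center K A := by
  rw [Subalgebra.mem_center_iff] at hv ⊢
  intro b
  have := congrArg α (hv (α.symm b))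
  simpa using this

theorem vSum_mem_center (α : A ≃ₐ[K] A) {v : A} (hv : v ∈ Subalgebra.center K A) (n : ℕ) :
    vSum α v n ∈ Subalgebra.center K A :=
  Subalgebra.sum_mem _ fun l _ => apply_mem_center (α ^ l) hv

/-- The additive map underlying the derivation `deltaExt`. -/
def deltaHom (α : A ≃ₐ[K] A) (v : A) : SkewPoly α →+ SkewPoly α :=
  liftAdd fun n => (monomial (n - 1)).comp
    ((AddMonoidHom.mulRight (vSum α v n)).comp (α.symm : A →+* A).toAddMonoidHom)

theorem deltaHom_monomial (α : A ≃ₐ[K] A) (v : A) (n : ℕ) (a : A) :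
    deltaHom α v (monomial n a) = monomial (n - 1) (α.symm a * vSum α v n) :=
  liftAdd_monomial _ n a

/-- The `β`-derivation `δ` of `A[y; α]` with `δ(A) = 0` and `δ(y) = v` (`v` central in `A`);
explicitly `δ(a yⁿ) = β(a) v⁽ⁿ⁾ yⁿ⁻¹`. -/
def deltaExt (α : A ≃ₐ[K] A) (v : Subalgebra.center K A) : SkewDerivation (betaExt α) where
  toAddHom := deltaHom α v
  leibniz f g := by
    suffices h : (AddMonoidHom.mul.compr₂ (deltaHom α v) :
          SkewPoly α →+ SkewPoly α →+ SkewPoly α)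
        = (AddMonoidHom.mul.comp (betaExt α).toAddMonoidHom).compl₂ (deltaHom α v)
          + AddMonoidHom.mul.comp (deltaHom α v) from
      DFunLike.congr_fun (DFunLike.congr_fun h f) g
    refine addHom_ext' fun n a => addHom_ext' fun m b => ?_
    have hβ : ∀ f, (betaExt α).toAddMonoidHom f = betaExt α f := fun _ => rfl
    simp only [AddMonoidHom.compr₂_apply, AddMonoidHom.mul_apply, AddMonoidHom.compl₂_apply,
      AddMonoidHom.comp_apply, AddMonoidHom.add_apply, hβ, betaExt_monomial, deltaHom_monomial,
      skewPoly_mul, map_mul]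
    have hc : ∀ k, α.symm ((α ^ k) b) = (α ^ k) (α.symm b) := fun k => by
      have hc : α.symm * α ^ k = α ^ k * α.symm :=
        ((Commute.refl α).inv_left.pow_right k).eq
      exact DFunLike.congr_fun hc b
    have hcen : ∀ k w, w * vSum α v k = vSum α v k * w := fun k =>
      Subalgebra.mem_center_iff.1 (vSum_mem_center α v.2 k)
    rcases n with _ | n
    · simp [vSum, mul_assoc]
    · have e1 : n + 1 + m - 1 = n + m := by omega
      have e2 : α.symm ((α ^ (n + 1)) b) = (α ^ n) b := by
        rw [pow_succ']; exact α.symm_apply_apply _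
      have e3 : (α ^ (n + 1)) (α.symm b) = (α ^ n) b := by rw [← hc, e2]
      rw [e1, e2, e3, Nat.add_sub_cancel]
      rcases m with _ | m
      · simp only [vSum, Finset.range_zero, Finset.sum_empty, map_zero, mul_zero, zero_add,
          add_zero]
        rw [mul_assoc, mul_assoc]
        exact congrArg (fun t => monomial n (α.symm a * t)) (hcen (n + 1) _)
      · have e4 : n + 1 + (m + 1 - 1) = n + (m + 1) := by omega
        rw [e4, ← map_add]
        congr 1
        rw [vSum_add, mul_add, add_comm, mul_assoc, mul_assoc, mul_assoc,
          hcen (n + 1) ((α ^ n) b)]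

/-- The ambiskew polynomial algebra `R(A, α, v, 1) = A[y; α][x; β, δ]`, where `v` is central in
`A`, `β = α⁻¹`, `β(y) = y`, `δ(A) = 0` and `δ(y) = v`.  Thus `y a = α(a) y`, `x a = β(a) x` and
`x y = y x + v`. -/
abbrev AmbiskewAlgebra (α : A ≃ₐ[K] A) (v : Subalgebra.center K A) : Type _ :=
  OreExtension (betaExt α) (deltaExt α v)

namespace AmbiskewAlgebra

variable (α : A ≃ₐ[K] A) (v : Subalgebra.center K A)

/-- The inclusion of `A` in `R(A, α, v, 1)`. -/
def ofBase : A →+* AmbiskewAlgebra α v := C.comp C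

/-- The generator `y`. -/
def y : AmbiskewAlgebra α v := C X

/-- The generator `x`. -/
def x : AmbiskewAlgebra α v := X

/-- The element `z = x y - u`; it is the Casimir element when `u` is central with
`v = u - α(u)`. -/
def casimir (u : A) : AmbiskewAlgebra α v := x α v * y α v - ofBase α v u

theorem y_mul_ofBase (a : A) : y α v * ofBase α v a = ofBase α v (α a) * y α v := by
  change C X * C (C a) = C (C (α a)) * C X
  rw [← map_mul, ← map_mul, X_mul_C]
  change C (C (α a) * X + C 0) = _
  rw [map_zero, add_zero]

theorem x_mul_ofBase (a : A) : x α v * ofBase α v a = ofBase α v (α.symm a) * x α v := by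
  change X * C (C a) = C (C (α.symm a)) * X
  rw [X_mul_C, C_apply a, betaExt_monomial]
  have : (deltaExt α v).toAddHom (monomial 0 a) = 0 := by
    change deltaHom α v _ = 0
    rw [deltaHom_monomial]; simp [vSum]
  rw [this]; simp [C_apply]

theorem x_mul_y : x α v * y α v = y α v * x α v + ofBase α v v := by
  change X * C X = C X * X + C (C (v : A))
  rw [X_mul_C]
  have h1 : betaExt α X = X := by
    unfold X; rw [betaExt_monomial]; simp
  have h2 : (deltaExt α v).toAddHom X = C (v : A) := by
    change deltaHom α v _ = _
    unfold X; rw [deltaHom_monomial]; simp [vSum, C_apply]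
  rw [h1, h2]

theorem casimir_sub_mem_center (u : Subalgebra.center K A) (hv : (v : A) = u - α u) (lam : K) :
    casimir α v u - ofBase α v (algebraMap K A lam) ∈ Subring.center (AmbiskewAlgebra α v) := by
  have hu := Subalgebra.mem_center_iff.1 u.2
  have hαu := Subalgebra.mem_center_iff.1 (apply_mem_center α u.2)
  have hxy := x_mul_y α v
  have hz : casimir α v u = y α v * x α v - ofBase α v (α u) := by
    rw [casimir, hxy, hv, map_sub]; abel
  have key : ∀ r : AmbiskewAlgebra α v, r * casimir α v u = casimir α v u * r →
      r * ofBase α v (algebraMap K A lam) = ofBase α v (algebraMap K A lam) * r →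
      r * (casimir α v u - ofBase α v (algebraMap K A lam))
        = (casimir α v u - ofBase α v (algebraMap K A lam)) * r := by
    intro r h1 h2
    rw [mul_sub, sub_mul, h1, h2]
  have hA : ∀ a : A, ofBase α v a * (casimir α v u - ofBase α v (algebraMap K A lam))
      = (casimir α v u - ofBase α v (algebraMap K A lam)) * ofBase α v a := by
    intro a
    apply key
    · rw [casimir, mul_sub, sub_mul, ← map_mul, ← map_mul, hu a, mul_assoc, y_mul_ofBase,
        ← mul_assoc (x α v), x_mul_ofBase, AlgEquiv.symm_apply_apply, mul_assoc]
    · rw [← map_mul, ← map_mul, Algebra.commutes]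
  have hY : y α v * (casimir α v u - ofBase α v (algebraMap K A lam))
      = (casimir α v u - ofBase α v (algebraMap K A lam)) * y α v := by
    apply key
    · conv_rhs => rw [hz]
      rw [casimir, mul_sub, sub_mul, y_mul_ofBase, mul_assoc]
    · rw [y_mul_ofBase]; simp
  have hX : x α v * (casimir α v u - ofBase α v (algebraMap K A lam))
      = (casimir α v u - ofBase α v (algebraMap K A lam)) * x α v := by
    apply key
    · conv_lhs => rw [hz]
      rw [casimir, mul_sub, sub_mul, x_mul_ofBase, AlgEquiv.symm_apply_apply, mul_assoc]
    · rw [x_mul_ofBase]; simp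
  refine OreExtension.mem_center (fun s => ?_) hX
  suffices h : (AddMonoidHom.mulRight (casimir α v u - ofBase α v (algebraMap K A lam))).comp
        (C : SkewPoly α →+* AmbiskewAlgebra α v).toAddMonoidHom
      = (AddMonoidHom.mulLeft (casimir α v u - ofBase α v (algebraMap K A lam))).comp
        (C : SkewPoly α →+* AmbiskewAlgebra α v).toAddMonoidHom from DFunLike.congr_fun h s
  refine addHom_ext' fun n a => ?_
  have h1 : Commute (ofBase α v a) (casimir α v u - ofBase α v (algebraMap K A lam)) := hA a
  have h2 : Commute (y α v) (casimir α v u - ofBase α v (algebraMap K A lam)) := hY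
  have e : (C : SkewPoly α →+* AmbiskewAlgebra α v).toAddMonoidHom (monomial n a)
      = ofBase α v a * y α v ^ n := by
    change C (monomial n a) = C (C a) * (C X) ^ n
    rw [monomial_eq, map_mul, map_pow]
  simp only [AddMonoidHom.comp_apply, e, AddMonoidHom.coe_mulLeft, AddMonoidHom.mulRight_apply]
  exact (h1.mul_left (h2.pow_left n)).eq

end AmbiskewAlgebra

end Ambiskew

/-! ## Ideals -/

/-- For a central element `c` of a ring `T`, the two-sided ideal `c T = {c t : t ∈ T}`. -/
def centralIdeal {T : Type*} [Ring T] (c : T) (hc : c ∈ Subring.center T) : TwoSidedIdeal T :=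
  TwoSidedIdeal.mk' {t | ∃ r, t = c * r} ⟨0, by simp⟩
    (by rintro _ _ ⟨r, rfl⟩ ⟨s, rfl⟩; exact ⟨r + s, by rw [mul_add]⟩)
    (by rintro _ ⟨r, rfl⟩; exact ⟨-r, by rw [mul_neg]⟩)
    (by
      rintro w _ ⟨r, rfl⟩
      exact ⟨w * r, by rw [← mul_assoc, Subring.mem_center_iff.1 hc w, mul_assoc]⟩)
    (by rintro _ w ⟨r, rfl⟩; exact ⟨r * w, by rw [mul_assoc]⟩)

/-- A completely prime ideal: a proper two-sided ideal `I` such that the quotient by `I` has no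
zero divisors. -/
def IsCompletelyPrime {T : Type*} [Ring T] (I : TwoSidedIdeal T) : Prop :=
  I ≠ ⊤ ∧ ∀ a b : T, a * b ∈ I → a ∈ I ∨ b ∈ I

/-! ## Quantum tori -/

/-- The quantum torus over `K` with generators `zᵢ^{±1}` (`i : ι`) and relations
`zᵢ zⱼ = Q i j zⱼ zᵢ` for `j < i` (only the entries `Q i j` with `j < i` are used), realised on
its `K`-basis of ordered monomials `z^n = ∏ zᵢ^{nᵢ}`, `n ∈ ℤ^ι` (factors in increasing order of
`i`); `Finsupp.single n a` is `a z^n`. -/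
def QuantumTorus (K : Type*) [Field K] {ι : Type*} [LinearOrder ι] [Fintype ι]
    (_Q : ι → ι → Kˣ) : Type _ :=
  (ι → ℤ) →₀ K

namespace QuantumTorus

variable {K : Type*} [Field K] {ι : Type*} [LinearOrder ι] [Fintype ι] {Q : ι → ι → Kˣ}

instance : AddCommGroup (QuantumTorus K Q) := inferInstanceAs (AddCommGroup ((ι → ℤ) →₀ K))

instance : Module K (QuantumTorus K Q) := inferInstanceAs (Module K ((ι → ℤ) →₀ K))

/-- The scalar `∏_{j < i} Q i j ^ (mᵢ nⱼ)`, for which `z^m z^n = cocycle Q m n • z^(m+n)`. -/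
def cocycle (Q : ι → ι → Kˣ) (m n : ι → ℤ) : Kˣ :=
  ∏ i, ∏ j, if j < i then Q i j ^ (m i * n j) else 1

theorem cocycle_add_left (l m n : ι → ℤ) :
    cocycle Q (l + m) n = cocycle Q l n * cocycle Q m n := by
  simp only [cocycle, ← Finset.prod_mul_distrib]
  refine Finset.prod_congr rfl fun i _ => Finset.prod_congr rfl fun j _ => ?_
  split_ifs <;> simp [add_mul, zpow_add]

theorem cocycle_add_right (l m n : ι → ℤ) :
    cocycle Q l (m + n) = cocycle Q l m * cocycle Q l n := by
  simp only [cocycle, ← Finset.prod_mul_distrib]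
  refine Finset.prod_congr rfl fun i _ => Finset.prod_congr rfl fun j _ => ?_
  split_ifs <;> simp [mul_add, zpow_add]

theorem cocycle_zero_left (n : ι → ℤ) : cocycle Q 0 n = 1 := by simp [cocycle]

theorem cocycle_zero_right (n : ι → ℤ) : cocycle Q n 0 = 1 := by simp [cocycle]

/-- `a z^n`, linear in `a`. -/
def monomial (n : ι → ℤ) : K →ₗ[K] QuantumTorus K Q := Finsupp.lsingle n

/-- Linear maps out of the quantum torus, given on the monomials. -/
def lift {M : Type*} [AddCommGroup M] [Module K M] (f : (ι → ℤ) → K →ₗ[K] M) :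
    QuantumTorus K Q →ₗ[K] M :=
  Finsupp.lsum K f

theorem lift_monomial {M : Type*} [AddCommGroup M] [Module K M] (f : (ι → ℤ) → K →ₗ[K] M)
    (n : ι → ℤ) (a : K) : lift (Q := Q) f (monomial n a) = f n a := by
  exact (Finsupp.lsum_single (S := K) f n a)

theorem hom_ext {M : Type*} [AddCommGroup M] [Module K M] {f g : QuantumTorus K Q →ₗ[K] M}
    (h : ∀ n, f (monomial n 1) = g (monomial n 1)) : f = g :=
  Finsupp.lhom_ext' fun n => LinearMap.ext_ring (h n)

/-- Multiplication: `(a z^m) (b z^n) = a b (cocycle Q m n) z^(m+n)`. -/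
def mulHom : QuantumTorus K Q →ₗ[K] QuantumTorus K Q →ₗ[K] QuantumTorus K Q :=
  lift fun m => LinearMap.toSpanSingleton K _
    (lift fun n => (cocycle Q m n : K) • monomial (m + n))

theorem mulHom_monomial (m n : ι → ℤ) (a b : K) :
    mulHom (monomial m a : QuantumTorus K Q) (monomial n b)
      = monomial (m + n) (a * b * cocycle Q m n) := by
  simp only [mulHom, lift_monomial, LinearMap.toSpanSingleton_apply, LinearMap.smul_apply,
    ← map_smul, smul_eq_mul]
  congr 1; ring

instance : Ring (QuantumTorus K Q) where
  __ := (inferInstance : AddCommGroup (QuantumTorus K Q))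
  mul f g := mulHom f g
  one := monomial 0 1
  left_distrib f g h := map_add (mulHom f) g h
  right_distrib f g h := by
    change mulHom (f + g) h = mulHom f h + mulHom g h
    rw [map_add, LinearMap.add_apply]
  zero_mul f := by
    change mulHom 0 f = 0
    rw [map_zero, LinearMap.zero_apply]
  mul_zero f := map_zero (mulHom f)
  mul_assoc f g h := by
    change mulHom (mulHom f g) h = mulHom f (mulHom g h)
    suffices H : (mulHom.compr₂ mulHom :
          QuantumTorus K Q →ₗ[K] QuantumTorus K Q →ₗ[K] QuantumTorus K Q →ₗ[K] QuantumTorus K Q)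
        = LinearMap.compl₂ ((LinearMap.llcomp K _ _ _).comp mulHom) mulHom from
      LinearMap.congr_fun (LinearMap.congr_fun (LinearMap.congr_fun H f) g) h
    refine hom_ext fun l => hom_ext fun m => hom_ext fun n => ?_
    simp only [LinearMap.compr₂_apply, LinearMap.compl₂_apply, LinearMap.comp_apply,
      LinearMap.llcomp_apply, mulHom_monomial, add_assoc, cocycle_add_left, cocycle_add_right]
    congr 1
    push_cast; ring
  one_mul f := by
    change mulHom (monomial 0 1) f = f
    suffices H : (mulHom (monomial 0 1) : QuantumTorus K Q →ₗ[K] _) = LinearMap.id from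
      LinearMap.congr_fun H f
    refine hom_ext fun n => ?_
    simp [mulHom_monomial, cocycle_zero_left]
  mul_one f := by
    change mulHom f (monomial 0 1) = f
    suffices H : (LinearMap.flip mulHom (monomial 0 1) : QuantumTorus K Q →ₗ[K] _)
        = LinearMap.id from LinearMap.congr_fun H f
    refine hom_ext fun n => ?_
    simp [mulHom_monomial, cocycle_zero_right]

theorem mul_def (f g : QuantumTorus K Q) : f * g = mulHom f g := rfl

theorem one_def : (1 : QuantumTorus K Q) = monomial 0 1 := rfl

instance : Algebra K (QuantumTorus K Q) :=
  Algebra.ofModule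
    (fun r f g => by
      simp only [mul_def, map_smul, LinearMap.smul_apply])
    (fun r f g => by
      simp only [mul_def, map_smul])

theorem monomial_mul_monomial (m n : ι → ℤ) (a b : K) :
    (monomial m a * monomial n b : QuantumTorus K Q)
      = monomial (m + n) (a * b * cocycle Q m n) :=
  mulHom_monomial m n a b

/-- The power `zᵢ^k` of the generator `zᵢ`, `k ∈ ℤ`. -/
def genPow (i : ι) (k : ℤ) : QuantumTorus K Q := monomial (Pi.single i k) 1

/-- The defining relations `zᵢ zⱼ = Q i j zⱼ zᵢ` for `j < i`. -/
theorem gen_mul_gen {i j : ι} (hij : j < i) :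
    (genPow i 1 * genPow j 1 : QuantumTorus K Q)
      = (Q i j : K) • (genPow j 1 * genPow i 1) := by
  have h1 : cocycle Q (Pi.single i 1) (Pi.single j 1) = Q i j := by
    rw [cocycle, Finset.prod_eq_single i, Finset.prod_eq_single j]
    · simp [hij]
    · intro b _ hb; simp [hb]
    · simp
    · intro b _ hb; simp [hb]
    · simp
  have h2 : cocycle Q (Pi.single j 1) (Pi.single i 1) = 1 := by
    refine Finset.prod_eq_one fun a _ => Finset.prod_eq_one fun b _ => ?_
    by_cases ha : a = j
    · by_cases hb : b = i
      · subst ha hb; simp [hij.not_gt]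
      · simp [hb]
    · simp [ha]
  rw [genPow, genPow, monomial_mul_monomial, monomial_mul_monomial, h1, h2, ← map_smul, add_comm]
  simp

/-- The scalar `∏ᵢ χᵢ^{nᵢ}`. -/
def character (χ : ι → Kˣ) (n : ι → ℤ) : Kˣ := ∏ i, χ i ^ n i

set_option linter.unusedSectionVars false in
theorem character_add (χ : ι → Kˣ) (m n : ι → ℤ) :
    character χ (m + n) = character χ m * character χ n := by
  simp [character, zpow_add, Finset.prod_mul_distrib]

/-- The `K`-endomorphism with `zᵢ ↦ χᵢ zᵢ`, i.e. `z^n ↦ (∏ᵢ χᵢ^{nᵢ}) z^n`. -/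
def scaleHom (χ : ι → Kˣ) : QuantumTorus K Q →ₐ[K] QuantumTorus K Q :=
  AlgHom.ofLinearMap (lift fun n => (character χ n : K) • monomial n)
    (by simp [one_def, lift_monomial, character])
    (by
      intro f g
      let F : QuantumTorus K Q →ₗ[K] QuantumTorus K Q :=
        lift fun n => (character χ n : K) • monomial n
      have hF : ∀ n a, F (monomial n a) = (character χ n : K) • monomial n a :=
        fun n a => lift_monomial _ n a
      change mulHom.compr₂ F f g = (mulHom.comp F).compl₂ F f g
      refine LinearMap.congr_fun (LinearMap.congr_fun ?_ f) g
      refine hom_ext fun m => hom_ext fun n => ?_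
      simp only [LinearMap.compr₂_apply, LinearMap.compl₂_apply, LinearMap.comp_apply, hF,
        mulHom_monomial, map_smul, LinearMap.smul_apply, character_add, smul_smul]
      push_cast
      rw [mul_comm (character χ m : K)])

theorem scaleHom_monomial (χ : ι → Kˣ) (n : ι → ℤ) (a : K) :
    scaleHom χ (monomial n a : QuantumTorus K Q) = (character χ n : K) • monomial n a :=
  lift_monomial _ n a

theorem scaleHom_comp (χ ψ : ι → Kˣ) (h : ∀ i, χ i * ψ i = 1) :
    (scaleHom χ).comp (scaleHom ψ) = AlgHom.id K (QuantumTorus K Q) := by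
  have hc : ∀ n, (character ψ n : K) * character χ n = 1 := fun n => by
    have : character ψ n * character χ n = 1 := by
      simp only [character, ← Finset.prod_mul_distrib, ← mul_zpow]
      exact Finset.prod_eq_one fun i _ => by rw [mul_comm, h i, one_zpow]
    rw [← Units.val_mul, this, Units.val_one]
  refine AlgHom.toLinearMap_injective (hom_ext fun n => ?_)
  simp [scaleHom_monomial, smul_smul, hc]

/-- The `K`-automorphism with `zᵢ ↦ χᵢ zᵢ`. -/
def scale (χ : ι → Kˣ) : QuantumTorus K Q ≃ₐ[K] QuantumTorus K Q :=
  AlgEquiv.ofAlgHom (scaleHom χ) (scaleHom χ⁻¹)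
    (scaleHom_comp _ _ fun i => by simp) (scaleHom_comp _ _ fun i => by simp)

theorem scale_monomial (χ : ι → Kˣ) (n : ι → ℤ) (a : K) :
    scale χ (monomial n a : QuantumTorus K Q) = (character χ n : K) • monomial n a :=
  scaleHom_monomial χ n a

end QuantumTorus

/-! ## The quantum torus `A` in `p` generators, `p` odd, and its ambiskew algebra `R`

The generators `z₁, …, z_p` are indexed by `Fin p`; the index `i : Fin p` stands for the
generator number `i + 1`. -/

section Example

variable {K : Type*} [Field K]

/-- The parameters: `q_{ij} = q⁻¹` if `i` is even and `j` is odd, and `q_{ij} = 1` otherwise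
(generators numbered `1, …, p`). -/
def torusMatrix (p : ℕ) (q : Kˣ) (i j : Fin p) : Kˣ :=
  if Even (i.val + 1) ∧ Odd (j.val + 1) then q⁻¹ else 1

/-- The quantum torus `A`. -/
abbrev TorusA (p : ℕ) (q : Kˣ) : Type _ := QuantumTorus K (torusMatrix p q)

/-- The automorphism `α`: `α(zᵢ) = zᵢ` for `i` even and `α(zᵢ) = q⁻¹ zᵢ` for `i` odd
(generators numbered `1, …, p`). -/
def torusAlpha (p : ℕ) (q : Kˣ) : TorusA p q ≃ₐ[K] TorusA p q :=
  QuantumTorus.scale fun i => if Even (i.val + 1) then 1 else q⁻¹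

/-- The index of the last generator `z_p`. -/
def lastIndex {p : ℕ} (hp : Odd p) : Fin p := ⟨p - 1, Nat.sub_lt hp.pos one_pos⟩

theorem genPow_lastIndex_mem_center {p : ℕ} (hp : Odd p) (q : Kˣ) (k : ℤ) :
    (QuantumTorus.genPow (lastIndex hp) k : TorusA p q) ∈ Subalgebra.center K (TorusA p q) := by
  have h1 : ∀ n, QuantumTorus.cocycle (torusMatrix p q) (Pi.single (lastIndex hp) k) n = 1 := by
    intro n
    refine Finset.prod_eq_one fun a _ => Finset.prod_eq_one fun b _ => ?_
    by_cases ha : a = lastIndex hp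
    · subst ha
      have : torusMatrix p q (lastIndex hp) b = 1 := by
        have hpe : (lastIndex hp).val + 1 = p := Nat.sub_add_cancel hp.pos
        rw [torusMatrix, hpe, if_neg]
        exact fun h => (Nat.not_even_iff_odd.2 hp) h.1
      simp [this]
    · simp [ha]
  have h2 : ∀ n, QuantumTorus.cocycle (torusMatrix p q) n (Pi.single (lastIndex hp) k) = 1 := by
    intro n
    refine Finset.prod_eq_one fun a _ => Finset.prod_eq_one fun b _ => ?_
    by_cases hb : b = lastIndex hp
    · subst hb
      have : ¬ lastIndex hp < a := by
        have := a.isLt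
        simp only [lastIndex, Fin.lt_def]
        omega
      simp [this]
    · simp [hb]
  rw [Subalgebra.mem_center_iff]
  intro f
  rw [QuantumTorus.mul_def, QuantumTorus.mul_def]
  change LinearMap.flip QuantumTorus.mulHom (QuantumTorus.genPow (lastIndex hp) k) f = _
  refine LinearMap.congr_fun (QuantumTorus.hom_ext fun n => ?_) f
  simp [QuantumTorus.genPow, QuantumTorus.mulHom_monomial, h1, h2, add_comm]

/-- The central element `z_p^k` of `A`, `k ∈ ℤ`. -/
def zLastPow {p : ℕ} (hp : Odd p) (q : Kˣ) (k : ℤ) : Subalgebra.center K (TorusA p q) :=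
  ⟨QuantumTorus.genPow (lastIndex hp) k, genPow_lastIndex_mem_center hp q k⟩

/-- `v = (1 - q) (q^{(p-1)/2} z_p⁻¹ - z_p)`. -/
def torusV {p : ℕ} (hp : Odd p) (q : Kˣ) : Subalgebra.center K (TorusA p q) :=
  (1 - (q : K)) • ((q : K) ^ ((p - 1) / 2) • zLastPow hp q (-1) - zLastPow hp q 1)

/-- `u = q^{(p-1)/2} z_p⁻¹ + q z_p`. -/
def torusU {p : ℕ} (hp : Odd p) (q : Kˣ) : Subalgebra.center K (TorusA p q) :=
  (q : K) ^ ((p - 1) / 2) • zLastPow hp q (-1) + (q : K) • zLastPow hp q 1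

theorem torusAlpha_zLastPow {p : ℕ} (hp : Odd p) (q : Kˣ) (k : ℤ) :
    torusAlpha p q (zLastPow hp q k : TorusA p q)
      = ((q⁻¹ ^ k : Kˣ) : K) • (zLastPow hp q k : TorusA p q) := by
  change torusAlpha p q (QuantumTorus.monomial _ 1) = _ • QuantumTorus.monomial _ 1
  rw [torusAlpha, QuantumTorus.scale_monomial]
  congr 2
  rw [QuantumTorus.character, Finset.prod_eq_single (lastIndex hp)]
  · have hpe : (lastIndex hp).val + 1 = p := Nat.sub_add_cancel hp.pos
    rw [hpe, if_neg (Nat.not_even_iff_odd.2 hp)]; simp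
  · intro b _ hb; simp [hb]
  · simp

/-- `u` is a splitting element. -/
theorem torusV_eq {p : ℕ} (hp : Odd p) (q : Kˣ) :
    (torusV hp q : TorusA p q) = torusU hp q - torusAlpha p q (torusU hp q) := by
  have hq : (q : K) ≠ 0 := q.ne_zero
  simp only [torusV, torusU, Subalgebra.coe_add, Subalgebra.coe_sub, Subalgebra.coe_smul, map_add,
    map_smul, torusAlpha_zLastPow, smul_smul]
  simp only [zpow_neg, zpow_one, inv_inv, Units.val_inv_eq_inv_val]
  rw [mul_inv_cancel₀ hq]
  module

/-- The ambiskew polynomial algebra `R = R(A, α, v, 1)`. -/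
abbrev TorusR {p : ℕ} (hp : Odd p) (q : Kˣ) : Type _ :=
  AmbiskewAlgebra (torusAlpha p q) (torusV hp q)

/-- The element `z - λ` of `R`, where `z = x y - u` is the Casimir element. -/
def casimirSub {p : ℕ} (hp : Odd p) (q : Kˣ) (lam : K) : TorusR hp q :=
  AmbiskewAlgebra.casimir (torusAlpha p q) (torusV hp q) (torusU hp q)
    - AmbiskewAlgebra.ofBase (torusAlpha p q) (torusV hp q) (algebraMap K (TorusA p q) lam)

/-- The ideal `(z - λ) R` of `R`. -/
def casimirIdeal {p : ℕ} (hp : Odd p) (q : Kˣ) (lam : K) : TwoSidedIdeal (TorusR hp q) :=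
  centralIdeal (casimirSub hp q lam)
    (AmbiskewAlgebra.casimir_sub_mem_center _ _ (torusU hp q) (torusV_eq hp q) lam)

/-- The central element `α^m(u + λ)` of `A`. -/
def shiftedU {p : ℕ} (hp : Odd p) (q : Kˣ) (lam : K) (m : ℕ) : TorusA p q :=
  (torusAlpha p q ^ m) (torusU hp q + algebraMap K (TorusA p q) lam)

theorem shiftedU_mem_center {p : ℕ} (hp : Odd p) (q : Kˣ) (lam : K) (m : ℕ) :
    shiftedU hp q lam m ∈ Subring.center (TorusA p q) := by
  have h : shiftedU hp q lam m ∈ Subalgebra.center K (TorusA p q) :=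
    apply_mem_center _ (add_mem (torusU hp q).2 (Subalgebra.algebraMap_mem _ lam))
  rw [Subalgebra.mem_center_iff] at h
  exact Subring.mem_center_iff.2 h

/-- The ideal `(u + λ) A + α^m(u + λ) A` of `A`. -/
def torusIdeal {p : ℕ} (hp : Odd p) (q : Kˣ) (lam : K) (m : ℕ) : TwoSidedIdeal (TorusA p q) :=
  centralIdeal (shiftedU hp q lam 0) (shiftedU_mem_center hp q lam 0)
    ⊔ centralIdeal (shiftedU hp q lam m) (shiftedU_mem_center hp q lam m)

end Example

end

end Ambiskew

/-! Put w = u + λ. Modulo z - λ the relations become xy = w and yx = α(w), so R/(z - λ)R behaves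
like a generalized Weyl algebra: each element is congruent to a sum of terms a yⁿ and a xⁿ with a ∈
A. Its simplicity is governed by whether w and α^m(w) are comaximal for every m ≥ 1.

Suppose wA + α^m(w)A is proper for some m. A homomorphism from A killing w and α^m(w) yields a
ladder with m rungs on which y and x step down and up; the two vanishing conditions are what is
needed at its two ends (`exists_truncated_representation`). The kernel of this representation is
proper and contains z - λ and y^m. On the infinite ladder A^ℤ, also killed by z - λ, y is an
invertible shift (`exists_shift_representation`), so no power of y lies in (z - λ)R, and (z - λ)R is
not maximal.

Conversely, let I strictly contain (z - λ)R. Conjugation by z_p has distinct eigenvalues on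
different degrees, so I contains some a yⁿ or a xⁿ with a ≠ 0. The coefficients of powers of y in I
form a nonzero α-stable ideal of A, which is A itself (`one_mem_of_torusAlpha_stable`), so some yⁿ
lies in I. Comaximality then lowers n to 0 (`one_mem_of_y_pow_mem`).

Inside A, write c = q^{(p-1)/2}. Eliminating z_p from w and α^m(w) gives λ z_p + c(1 + q^m) and the
scalar λ²cq^{m-1} - c²(1 + q^m)² (`elimination_mem`). The scalar vanishes exactly at the two
critical values of λ. Then the ideal is the kernel of a specialization z_p ↦ t, whose image is a
quantum torus on the other p - 1 generators: a domain, and simple because commutators separate its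
monomials (`isCoatom_of_mem_iff`). Since q is not a root of unity, one λ cannot be critical for two
values of m. -/

namespace Ambiskew

/-! ### Universal property of Ore extensions. -/

namespace OreExtension

variable {S T : Type*} [Ring S] [Ring T] {σ : S →+* S} {δ : SkewDerivation σ}

/-- The universal property of an Ore extension. -/
noncomputable def liftRingHom (φ : S →+* T) (t : T)
    (h : ∀ s, t * φ s = φ (σ s) * t + φ (δ.toAddHom s)) : OreExtension σ δ →+* T :=
  let F : OreExtension σ δ →+ T :=
    liftAdd fun n => (AddMonoidHom.mulRight (t ^ n)).comp φ.toAddMonoidHom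
  have hF : ∀ n s, F (monomial n s) = φ s * t ^ n := fun n s => liftAdd_monomial _ n s
  have hC : ∀ s g, F (coeffMul s g) = φ s * F g := by
    intro s g
    induction g using OreExtension.induction with
    | zero => simp only [map_zero, mul_zero]
    | add f g hf hg => simp only [map_add, mul_add, hf, hg]
    | monomial n r => rw [coeffMul_monomial, hF, hF, map_mul, mul_assoc]
  have hX : ∀ g, F (varMul g) = t * F g := by
    intro g
    induction g using OreExtension.induction with
    | zero => simp only [map_zero, mul_zero]
    | add f g hf hg => simp only [map_add, mul_add, hf, hg]
    | monomial n r =>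
      rw [varMul_monomial, map_add, hF, hF, hF, ← mul_assoc, h, add_mul, mul_assoc, pow_succ']
  have hXn : ∀ n g, F ((varMul ^ n) g) = t ^ n * F g := by
    intro n g
    induction n with
    | zero => simp
    | succ n ih => rw [pow_succ', end_mul_apply, hX, ih, pow_succ', mul_assoc]
  { F with
    map_one' := by
      change F (monomial 0 1) = 1
      rw [hF, map_one, pow_zero, mul_one]
    map_mul' := by
      intro f g
      change F (mulHom f g) = F f * F g
      induction f using OreExtension.induction with
      | zero => rw [map_zero, map_zero, zero_mul]; exact map_zero F
      | add f f' hf hf' => rw [map_add, end_add_apply, map_add, hf, hf', map_add, add_mul]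
      | monomial n s => rw [mulHom_monomial, end_mul_apply, hC, hXn, hF, mul_assoc] }

variable (φ : S →+* T) (t : T) (h : ∀ s, t * φ s = φ (σ s) * t + φ (δ.toAddHom s))

theorem liftRingHom_monomial (n : ℕ) (s : S) :
    liftRingHom (δ := δ) φ t h (monomial n s) = φ s * t ^ n :=
  liftAdd_monomial _ n s

theorem liftRingHom_C (s : S) : liftRingHom (δ := δ) φ t h (C s) = φ s := by
  rw [C_apply, liftRingHom_monomial, pow_zero, mul_one]

theorem liftRingHom_X : liftRingHom (δ := δ) φ t h X = t := by
  rw [X, liftRingHom_monomial, map_one, one_mul, pow_one]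

end OreExtension

/-! ### Representations of R killing z - λ. -/

namespace AmbiskewAlgebra

open OreExtension

variable {K A T : Type*} [Field K] [Ring A] [Algebra K A] [Ring T]
  (α : A ≃ₐ[K] A) (v : Subalgebra.center K A)

/-- R is a twofold Ore extension, so the universal property is applied first to A[y; α] and then to
x. -/
theorem exists_lift (φ : A →+* T) (Y X : T) (hY : ∀ a, Y * φ a = φ (α a) * Y)
    (hX : ∀ a, X * φ a = φ (α.symm a) * X) (hXY : X * Y = Y * X + φ v) :
    ∃ F : AmbiskewAlgebra α v →+* T, (∀ a, F (ofBase α v a) = φ a) ∧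
      F (y α v) = Y ∧ F (x α v) = X := by
  have hY' : ∀ a, Y * φ a = φ ((α : A →+* A) a) * Y
      + φ ((SkewDerivation.zero (α : A →+* A)).toAddHom a) := by
    intro a
    rw [hY]
    change _ = _ + φ 0
    rw [map_zero, add_zero]; rfl
  let G : SkewPoly α →+* T := liftRingHom φ Y hY'
  have hβX : betaExt α OreExtension.X = OreExtension.X := by
    unfold OreExtension.X; rw [betaExt_monomial]; simp
  have hδX : (deltaExt α v).toAddHom OreExtension.X = C (v : A) := by
    change deltaHom α v _ = _
    unfold OreExtension.X; rw [deltaHom_monomial]; simp [vSum, C_apply]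
  -- This is the rule required to adjoin x. It is stable under sums, and under products by the
  -- Leibniz rule, so it need only be checked on A and on y.
  let P : SkewPoly α → Prop := fun s =>
    X * G s = G (betaExt α s) * X + G ((deltaExt α v).toAddHom s)
  have P_mul : ∀ s t, P s → P t → P (s * t) := by
    intro s t hs ht
    change X * G (s * t) = G (betaExt α (s * t)) * X + G ((deltaExt α v).toAddHom (s * t))
    rw [map_mul, ← mul_assoc, show X * G s = _ from hs, add_mul, mul_assoc (G _) X,
      show X * G t = _ from ht, (deltaExt α v).leibniz, map_mul, map_mul, map_add, map_mul, map_mul]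
    noncomm_ring
  have P_C : ∀ a, P (C a) := by
    intro a
    change X * G (C a) = G (betaExt α (C a)) * X + G (deltaHom α v (C a))
    rw [C_apply, betaExt_monomial, deltaHom_monomial]
    simp only [vSum, Finset.range_zero, Finset.sum_empty, mul_zero, map_zero, add_zero]
    change X * liftRingHom φ Y hY' (C a) = liftRingHom φ Y hY' (C (α.symm a)) * X
    rw [liftRingHom_C, liftRingHom_C, hX]
  have P_X : P OreExtension.X := by
    change X * G _ = _
    rw [hβX, hδX]
    change X * liftRingHom φ Y hY' _ = liftRingHom φ Y hY' _ * X + liftRingHom φ Y hY' _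
    rw [liftRingHom_C, liftRingHom_X, hXY]
  have P_all : ∀ s, P s := by
    intro s
    induction s using OreExtension.induction with
    | zero => change X * G 0 = _; simp only [map_zero, mul_zero, zero_mul, add_zero]
    | add f g hf hg =>
      change X * G (f + g) = _
      simp only [map_add, mul_add, add_mul]
      rw [show X * G f = _ from hf, show X * G g = _ from hg]
      abel
    | monomial n a =>
      rw [monomial_eq]
      refine P_mul _ _ (P_C a) ?_
      induction n with
      | zero => simpa using P_C 1
      | succ n ih => rw [pow_succ]; exact P_mul _ _ ih P_X
  refine ⟨liftRingHom G X P_all, fun a => ?_, ?_, ?_⟩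
  · exact (liftRingHom_C G X P_all _).trans (liftRingHom_C φ Y hY' a)
  · exact (liftRingHom_C G X P_all _).trans (liftRingHom_X φ Y hY')
  · exact liftRingHom_X G X P_all

/-- Operators `Y`, `X` with `X Y = u + λ` and `Y X = α(u + λ)` define a homomorphism from `R` that
kills `z - λ`. -/
theorem exists_lift_of_mul_eq {u : A} {lam : K} (hv : (v : A) = u - α u) (φ : A →+* T) (Y X : T)
    (hY : ∀ a, Y * φ a = φ (α a) * Y) (hX : ∀ a, X * φ a = φ (α.symm a) * X)
    (hXY : X * Y = φ (u + algebraMap K A lam)) (hYX : Y * X = φ (α (u + algebraMap K A lam))) :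
    ∃ F : AmbiskewAlgebra α v →+* T, (∀ a, F (ofBase α v a) = φ a) ∧ F (y α v) = Y ∧
      F (casimir α v u - ofBase α v (algebraMap K A lam)) = 0 := by
  obtain ⟨F, h1, h2, h3⟩ := exists_lift α v φ Y X hY hX (by
    rw [hXY, hYX, ← map_add, hv, map_add α, AlgEquiv.commutes]; congr 1; abel)
  refine ⟨F, h1, h2, ?_⟩
  rw [casimir, map_sub, map_sub, map_mul, h1, h1, h2, h3, hXY, map_add]
  abel

variable {α v} {u : Subalgebra.center K A} {lam : K}

/-- The representation of `R` on `A^ℤ` which kills `z - λ` and on which `y` acts by a shift. -/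
theorem exists_shift_representation (hv : (v : A) = u - α u) (lam : K) :
    ∃ F : AmbiskewAlgebra α v →+* AddMonoid.End (ℤ → A),
      F (casimir α v u - ofBase α v (algebraMap K A lam)) = 0 ∧
      ∀ (n : ℕ) (g : ℤ → A) (j : ℤ), F (y α v ^ n) g j = g (j + n) := by
  let w : A := u + algebraMap K A lam
  have hw : ∀ (j : ℤ) b, (α ^ j) w * b = b * (α ^ j) w := fun j b =>
    (Subalgebra.mem_center_iff.1 (apply_mem_center (α ^ j)
      (add_mem u.2 (Subalgebra.algebraMap_mem _ lam))) b).symm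
  -- Here a acts on slot j by α^j(a), y brings slot j + 1 to slot j, and x brings slot j - 1 to slot
  -- j with the factor α^j(w). Hence xy and yx act on slot j by α^j(w) and α^{j+1}(w).
  let φ : A →+* AddMonoid.End (ℤ → A) := (Module.toAddMonoidEnd (ℤ → A) (ℤ → A)).comp
    (RingHom.pi fun j : ℤ => ((α ^ j : A ≃ₐ[K] A) : A →+* A))
  have hφ : ∀ a g j, φ a g j = (α ^ j) a * g j := fun _ _ _ => rfl
  let Y : AddMonoid.End (ℤ → A) :=
    { toFun := fun g j => g (j + 1), map_zero' := rfl, map_add' := fun _ _ => rfl }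
  have hY : ∀ g j, Y g j = g (j + 1) := fun _ _ => rfl
  let X : AddMonoid.End (ℤ → A) :=
    { toFun := fun g j => (α ^ j) w * g (j - 1)
      map_zero' := by ext; simp
      map_add' := fun _ _ => by ext; simp [mul_add] }
  have hX : ∀ g j, X g j = (α ^ j) w * g (j - 1) := fun _ _ => rfl
  have hs : ∀ (j : ℤ) a, (α ^ j) (α a) = (α ^ (j + 1)) a := fun j a => by
    rw [zpow_add_one]; rfl
  have hs' : ∀ (j : ℤ) a, (α ^ j) (α.symm a) = (α ^ (j - 1)) a := fun j a => by
    rw [zpow_sub_one]; rfl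
  obtain ⟨F, -, h2, h3⟩ := exists_lift_of_mul_eq α v (lam := lam) hv φ Y X
    (fun a => by
      ext g j
      simp only [AddMonoid.End.coe_mul, Function.comp_apply, hY, hφ, hs])
    (fun a => by
      ext g j
      simp only [AddMonoid.End.coe_mul, Function.comp_apply, hX, hφ, hs']
      rw [← mul_assoc, hw, mul_assoc])
    (by
      ext g j
      simp only [AddMonoid.End.coe_mul, Function.comp_apply, hX, hφ, hY, sub_add_cancel]; rfl)
    (by
      ext g j
      simp only [AddMonoid.End.coe_mul, Function.comp_apply, hX, hφ, hY, add_sub_cancel_right, hs]; rfl)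
  refine ⟨F, h3, fun n => ?_⟩
  induction n with
  | zero => intro g j; simp
  | succ n ih =>
    intro g j
    rw [pow_succ, map_mul, AddMonoid.End.coe_mul, Function.comp_apply, ih, h2, hY]
    congr 1; push_cast; ring

/-- If a ring homomorphism from `A` kills `u + λ` and `α^m(u + λ)`, then `R` has a nonzero
representation which kills `z - λ` and `y^m`. -/
theorem exists_truncated_representation {B : Type*} [Ring B] [Nontrivial B]
    (hv : (v : A) = u - α u) (ψ : A →+* B) {m : ℕ} (hm : 1 ≤ m)
    (h0 : ψ (u + algebraMap K A lam) = 0) (h1 : ψ ((α ^ m) (u + algebraMap K A lam)) = 0) :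
    ∃ F : AmbiskewAlgebra α v →+* AddMonoid.End (Fin m → B), F 1 ≠ 0 ∧
      F (casimir α v u - ofBase α v (algebraMap K A lam)) = 0 ∧ F (y α v ^ m) = 0 := by
  have : Nonempty (Fin m) := ⟨⟨0, hm⟩⟩
  let w : A := u + algebraMap K A lam
  have hw : ∀ (j : ℕ) b, ψ ((α ^ j) w) * ψ b = ψ b * ψ ((α ^ j) w) := fun j b => by
    rw [← map_mul, ← map_mul, Subalgebra.mem_center_iff.1 (apply_mem_center (α ^ j)
      (add_mem u.2 (Subalgebra.algebraMap_mem _ lam))) b]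
  let φ : A →+* AddMonoid.End (Fin m → B) := (Module.toAddMonoidEnd (Fin m → B) (Fin m → B)).comp
    (RingHom.pi fun j : Fin m => ψ.comp ((α ^ j.val : A ≃ₐ[K] A) : A →+* A))
  have hφ : ∀ a g j, φ a g j = ψ ((α ^ j.val) a) * g j := fun _ _ _ => rfl
  let Y : AddMonoid.End (Fin m → B) :=
    { toFun := fun g j => if h : j.val + 1 < m then g ⟨j.val + 1, h⟩ else 0
      map_zero' := by ext; simp
      map_add' := fun _ _ => by ext j; by_cases h : j.val + 1 < m <;> simp [h] }
  have hY : ∀ g j, Y g j = if h : j.val + 1 < m then g ⟨j.val + 1, h⟩ else 0 := fun _ _ => rfl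
  let X : AddMonoid.End (Fin m → B) :=
    { toFun := fun g j => if 0 < j.val then
        ψ ((α ^ j.val) w) * g ⟨j.val - 1, (Nat.sub_le _ _).trans_lt j.2⟩ else 0
      map_zero' := by ext; simp
      map_add' := fun _ _ => by ext j; by_cases h : 0 < j.val <;> simp [h, mul_add] }
  have hX : ∀ g j, X g j = if 0 < j.val then
    ψ ((α ^ j.val) w) * g ⟨j.val - 1, (Nat.sub_le _ _).trans_lt j.2⟩ else 0 := fun _ _ => rfl
  have hs : ∀ (j : ℕ) a, (α ^ j) (α a) = (α ^ (j + 1)) a := fun j a => by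
    rw [pow_succ]; rfl
  have hs' : ∀ (j : ℕ) a, 0 < j → (α ^ j) (α.symm a) = (α ^ (j - 1)) a := fun j a hj => by
    obtain ⟨k, rfl⟩ : ∃ k, j = k + 1 := ⟨j - 1, by omega⟩
    rw [← hs, AlgEquiv.apply_symm_apply, Nat.add_sub_cancel]
  obtain ⟨F, -, h2, h3⟩ := exists_lift_of_mul_eq α v (lam := lam) hv φ Y X
    (fun a => by
      ext g j
      simp only [AddMonoid.End.coe_mul, Function.comp_apply, hY, hφ, hs]
      split_ifs <;> simp)
    (fun a => by
      ext g j
      simp only [AddMonoid.End.coe_mul, Function.comp_apply, hX, hφ]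
      split_ifs with hj
      · rw [← mul_assoc, hw, mul_assoc, hs' _ _ hj]
      · simp)
    (by
      ext g j
      simp only [AddMonoid.End.coe_mul, Function.comp_apply, hX, hφ, hY]
      split_ifs with hj hj'
      · congr 2; ext; simp only; omega
      · exact absurd j.2 (by omega)
      -- In slot 0 the composite XY is zero, so w must act there as zero.
      · have : j.val = 0 := by omega
        rw [this, pow_zero, AlgEquiv.one_apply, h0, zero_mul])
    (by
      ext g j
      simp only [AddMonoid.End.coe_mul, Function.comp_apply, hX, hφ, hY, hs]
      split_ifs with hj hj'
      · simp [w]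
      · omega
      -- In slot m - 1 the composite YX is zero, so α^m(w) must vanish under ψ.
      · have : j.val + 1 = m := by omega
        rw [this, h1, zero_mul])
  refine ⟨F, ?_, h3, ?_⟩
  · rw [map_one]
    intro h
    obtain ⟨g, hg⟩ := exists_ne (0 : Fin m → B)
    exact hg (DFunLike.congr_fun h g)
  -- Each application of Y feeds a zero in at the top slot, so after n of them the top n slots are
  -- empty.
  · have hn : ∀ (n : ℕ) g j, m ≤ j.val + n → F (y α v ^ n) g j = 0 := by
      intro n
      induction n with
      | zero => intro g j hj; exact absurd j.2 (by omega)
      | succ n ih =>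
        intro g j hj
        rw [pow_succ', map_mul, AddMonoid.End.coe_mul, Function.comp_apply, h2, hY]
        split_ifs with h
        · exact ih _ _ (by simp only; omega)
        · rfl
    ext g j
    exact hn m g j (by omega)

end AmbiskewAlgebra

/-! ### Central ideals, and the obstruction to maximality. -/

theorem mem_centralIdeal {T : Type*} [Ring T] {c : T} {hc : c ∈ Subring.center T} {t : T} :
    t ∈ centralIdeal c hc ↔ ∃ r, t = c * r :=
  TwoSidedIdeal.mem_mk' _ _ _ _ _ _ _

theorem self_mem_centralIdeal {T : Type*} [Ring T] {c : T} (hc : c ∈ Subring.center T) :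
    c ∈ centralIdeal c hc :=
  mem_centralIdeal.2 ⟨1, (mul_one c).symm⟩

theorem centralIdeal_le {T : Type*} [Ring T] {c : T} (hc : c ∈ Subring.center T)
    {I : TwoSidedIdeal T} (h : c ∈ I) : centralIdeal c hc ≤ I := by
  intro t ht
  obtain ⟨r, rfl⟩ := mem_centralIdeal.1 ht
  exact I.mul_mem_right _ _ h

namespace AmbiskewAlgebra

variable {K A : Type*} [Field K] [Ring A] [Algebra K A]
  {α : A ≃ₐ[K] A} {v : Subalgebra.center K A} {u : Subalgebra.center K A} {lam : K}

/-- In the shift representation every power of y fixes the constant function 1, whereas (z - λ)R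
acts as zero. -/
theorem y_pow_notMem [Nontrivial A] (hv : (v : A) = u - α u) (n : ℕ) :
    y α v ^ n ∉ centralIdeal _ (casimir_sub_mem_center α v u hv lam) := by
  intro h
  obtain ⟨F, h1, h2⟩ := exists_shift_representation hv lam
  obtain ⟨r, hr⟩ := mem_centralIdeal.1 h
  have h3 := h2 n 1 0
  rw [hr, map_mul, h1, zero_mul] at h3
  exact zero_ne_one h3

theorem centralIdeal_casimir_ne_top [Nontrivial A] (hv : (v : A) = u - α u) :
    centralIdeal _ (casimir_sub_mem_center α v u hv lam) ≠ ⊤ := by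
  intro h
  refine y_pow_notMem hv (lam := lam) 0 ?_
  rw [h]; exact TwoSidedIdeal.mem_top _

/-- The kernel of the truncated representation lies strictly between: it contains y^m, which is not
in (z - λ)R, and does not contain 1. -/
theorem not_isCoatom_of_ringHom [Nontrivial A] {B : Type*} [Ring B] [Nontrivial B]
    (hv : (v : A) = u - α u) (ψ : A →+* B) {m : ℕ} (hm : 1 ≤ m)
    (h0 : ψ (u + algebraMap K A lam) = 0) (h1 : ψ ((α ^ m) (u + algebraMap K A lam)) = 0) :
    ¬ IsCoatom (centralIdeal _ (casimir_sub_mem_center α v u hv lam)) := by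
  intro hco
  obtain ⟨F, hF, h2, h3⟩ := exists_truncated_representation hv ψ hm h0 h1
  have hle : centralIdeal _ (casimir_sub_mem_center α v u hv lam) ≤ TwoSidedIdeal.ker F :=
    centralIdeal_le _ ((TwoSidedIdeal.mem_ker F).2 h2)
  rcases hco.le_iff.1 hle with h | h
  · refine hF ((TwoSidedIdeal.mem_ker F).1 ?_)
    rw [h]; exact TwoSidedIdeal.mem_top _
  · refine y_pow_notMem hv (lam := lam) m ?_
    rw [← h]; exact (TwoSidedIdeal.mem_ker F).2 h3

end AmbiskewAlgebra

/-! ### Separation of eigenvectors modulo an ideal. -/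

/-- Eigenvectors of operators preserving an ideal: if a sum of joint eigenvectors with distinct
eigenvalues lies in the ideal, then so does each summand. -/
theorem mem_of_sum_mem {K T ι : Type*} [Field K] [Ring T] (φ : K →+* T) (I : TwoSidedIdeal T)
    (s : Finset ι) (f : ι → T)
    (hD : ∀ i ∈ s, ∀ j ∈ s, i ≠ j → ∃ D : T →+ T, (∀ x ∈ I, D x ∈ I) ∧
      (∀ c x, D (φ c * x) = φ c * D x) ∧
      ∃ χ : ι → K, (∀ k ∈ s, D (f k) = φ (χ k) * f k) ∧ χ i ≠ χ j)
    (h : ∑ i ∈ s, f i ∈ I) : ∀ i ∈ s, f i ∈ I := by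
  classical
  induction hn : s.card generalizing s f with
  | zero => rw [Finset.card_eq_zero.1 hn]; simp
  | succ n ih =>
    intro i hi
    by_cases hex : ∃ j ∈ s, i ≠ j
    · obtain ⟨j, hj, hij⟩ := hex
      obtain ⟨D, hI, hφ, χ, hχ, hne⟩ := hD i hi j hj hij
      have hsum : ∑ k ∈ s.erase j, φ (χ k - χ j) * f k ∈ I := by
        -- Applying D - χ(j) removes the j-th summand and scales the i-th by the nonzero factor χ(i)
        -- - χ(j), which is divided out at the end.
        have e : D (∑ k ∈ s, f k) - φ (χ j) * ∑ k ∈ s, f k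
            = ∑ k ∈ s.erase j, φ (χ k - χ j) * f k := by
          rw [map_sum, Finset.mul_sum, ← Finset.sum_sub_distrib, ← Finset.sum_erase_add _ _ hj,
            hχ j hj, sub_self, add_zero]
          refine Finset.sum_congr rfl fun k hk => ?_
          rw [hχ k (Finset.mem_of_mem_erase hk), map_sub, sub_mul]
        rw [← e]
        exact I.sub_mem (hI _ h) (I.mul_mem_left _ _ h)
      have h1 := ih (s.erase j) (fun k => φ (χ k - χ j) * f k) (by
        intro a ha b hb hab
        obtain ⟨D, hI, hφ, ψ, hψ, hne⟩ :=
          hD a (Finset.mem_of_mem_erase ha) b (Finset.mem_of_mem_erase hb) hab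
        refine ⟨D, hI, hφ, ψ, fun k hk => ?_, hne⟩
        rw [hφ, hψ k (Finset.mem_of_mem_erase hk), ← mul_assoc, ← mul_assoc, ← map_mul,
          ← map_mul, mul_comm]) hsum (by rw [Finset.card_erase_of_mem hj, hn]; rfl) i
        (Finset.mem_erase.2 ⟨hij, hi⟩)
      have h2 := I.mul_mem_left (φ (χ i - χ j)⁻¹) _ h1
      rwa [← mul_assoc, ← map_mul, inv_mul_cancel₀ (sub_ne_zero.2 hne), map_one, one_mul] at h2
    · push Not at hex
      have : s = {i} := Finset.eq_singleton_iff_unique_mem.2 ⟨hi, fun j hj => (hex j hj).symm⟩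
      rwa [this, Finset.sum_singleton] at h

/-! ### A simplicity criterion for R/(z - λ)R. -/

namespace AmbiskewAlgebra

open OreExtension

variable {K A : Type*} [Field K] [Ring A] [Algebra K A]
  {α : A ≃ₐ[K] A} {v : Subalgebra.center K A} {u : Subalgebra.center K A} {lam : K}

theorem induction_monomial {P : AmbiskewAlgebra α v → Prop} (f : AmbiskewAlgebra α v) (zero : P 0)
    (add : ∀ f g, P f → P g → P (f + g))
    (monomial : ∀ a i j, P (ofBase α v a * y α v ^ i * x α v ^ j)) : P f := by
  induction f using OreExtension.induction with
  | zero => exact zero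
  | add f g hf hg => exact add f g hf hg
  | monomial j s =>
    induction s using OreExtension.induction with
    | zero => rw [map_zero]; exact zero
    | add f g hf hg => rw [map_add]; exact add _ _ hf hg
    | monomial i a =>
      rw [monomial_eq, monomial_eq, map_mul, map_pow]
      exact monomial a i j

theorem y_pow_mul_ofBase (i : ℕ) (a : A) :
    y α v ^ i * ofBase α v a = ofBase α v ((α ^ i) a) * y α v ^ i := by
  induction i generalizing a with
  | zero => simp
  | succ i ih =>
    rw [pow_succ, mul_assoc, y_mul_ofBase, ← mul_assoc, ih, mul_assoc, pow_succ α]; rfl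

theorem x_pow_mul_ofBase (i : ℕ) (a : A) :
    x α v ^ i * ofBase α v a = ofBase α v ((α.symm ^ i) a) * x α v ^ i := by
  induction i generalizing a with
  | zero => simp
  | succ i ih =>
    rw [pow_succ, mul_assoc, x_mul_ofBase, ← mul_assoc, ih, mul_assoc, pow_succ α.symm]; rfl

theorem ofBase_algebraMap_mul (c : K) (f : AmbiskewAlgebra α v) :
    ofBase α v (algebraMap K A c) * f = f * ofBase α v (algebraMap K A c) := by
  induction f using induction_monomial with
  | zero => simp
  | add f g hf hg => rw [mul_add, add_mul, hf, hg]
  | monomial a i j =>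
    have h1 : Commute (ofBase α v (algebraMap K A c)) (ofBase α v a) := by
      change _ * _ = _ * _
      rw [← map_mul, ← map_mul, Algebra.commutes]
    have h2 : Commute (ofBase α v (algebraMap K A c)) (y α v) := by
      change _ * _ = _ * _
      rw [y_mul_ofBase, AlgEquiv.commutes]
    have h3 : Commute (ofBase α v (algebraMap K A c)) (x α v) := by
      change _ * _ = _ * _
      rw [x_mul_ofBase, AlgEquiv.commutes]
    exact ((h1.mul_right (h2.pow_right i)).mul_right (h3.pow_right j)).eq

section

variable (I : TwoSidedIdeal (AmbiskewAlgebra α v))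

theorem x_mul_y_sub_mem (hI : casimir α v u - ofBase α v (algebraMap K A lam) ∈ I) :
    x α v * y α v - ofBase α v (u + algebraMap K A lam) ∈ I := by
  convert hI using 1
  rw [casimir, map_add]; abel

theorem casimir_eq (hv : (v : A) = u - α u) :
    casimir α v u = y α v * x α v - ofBase α v (α u) := by
  rw [casimir, x_mul_y, hv, map_sub]; abel

theorem y_mul_x_sub_mem (hv : (v : A) = u - α u)
    (hI : casimir α v u - ofBase α v (algebraMap K A lam) ∈ I) :
    y α v * x α v - ofBase α v (α (u + algebraMap K A lam)) ∈ I := by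
  convert hI using 1
  rw [casimir_eq hv, map_add α, AlgEquiv.commutes, map_add]; abel

/-- Modulo an ideal containing `z - λ`, every element is a sum of terms `a yⁿ` and `a xⁿ`. -/
theorem exists_sub_sum_mem (hv : (v : A) = u - α u)
    (hI : casimir α v u - ofBase α v (algebraMap K A lam) ∈ I) (f : AmbiskewAlgebra α v) :
    ∃ a : ℤ →₀ A, f - a.sum (fun n b => ofBase α v b * y α v ^ n.toNat * x α v ^ (-n).toNat) ∈ I := by
  classical
  induction f using induction_monomial with
  | zero => exact ⟨0, by simp [I.zero_mem]⟩
  | add f g hf hg =>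
    obtain ⟨a, ha⟩ := hf
    obtain ⟨b, hb⟩ := hg
    refine ⟨a + b, ?_⟩
    rw [Finsupp.sum_add_index' (by simp) (by intros; simp [add_mul])]
    convert I.add_mem ha hb using 1
    abel
  | monomial a i j =>
    -- An inner factor yx is replaced by α(w), which moves left past yⁱ, until only y's or only x's
    -- remain. The index n records degree: yⁿ for n ≥ 0 and x^{-n} for n ≤ 0.
    induction i generalizing a j with
    | zero =>
      refine ⟨Finsupp.single (-(j : ℤ)) a, ?_⟩
      rw [Finsupp.sum_single_index (by simp)]
      have : (-(j : ℤ)).toNat = 0 := by omega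
      simp [this, I.zero_mem]
    | succ i ih =>
      rcases j with _ | j
      · refine ⟨Finsupp.single ((i + 1 : ℕ) : ℤ) a, ?_⟩
        rw [Finsupp.sum_single_index (by simp)]
        have : (-((i + 1 : ℕ) : ℤ)).toNat = 0 := by omega
        rw [this, Int.toNat_natCast, sub_self]
        exact I.zero_mem
      · obtain ⟨b, hb⟩ := ih (a * (α ^ i) (α (u + algebraMap K A lam))) j
        refine ⟨b, ?_⟩
        convert I.add_mem (I.mul_mem_left (ofBase α v a * y α v ^ i) _
          (I.mul_mem_right _ (x α v ^ j) (y_mul_x_sub_mem I hv hI))) hb using 1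
        rw [map_mul, mul_assoc (ofBase α v a) (ofBase α v _), ← y_pow_mul_ofBase, pow_succ,
          pow_succ' (x α v)]
        simp only [mul_assoc, sub_mul, mul_sub]
        abel

/-- Right multiplication by y turns a x^{j+1} into a x^j w, that is a α^{-j}(w) x^j, modulo the
ideal. The new coefficient is nonzero because A is a domain. -/
theorem exists_ofBase_mem_of_x_pow [NoZeroDivisors A]
    (hI : casimir α v u - ofBase α v (algebraMap K A lam) ∈ I)
    (hu : (u + algebraMap K A lam : A) ≠ 0) (j : ℕ) {a : A} (ha : a ≠ 0)
    (h : ofBase α v a * x α v ^ j ∈ I) : ∃ b, b ≠ 0 ∧ ofBase α v b ∈ I := by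
  induction j generalizing a with
  | zero => exact ⟨a, ha, by simpa using h⟩
  | succ j ih =>
    refine ih (a := a * (α.symm ^ j) (u + algebraMap K A lam)) (mul_ne_zero ha
      ((map_ne_zero_iff _ (α.symm ^ j).injective).2 hu)) ?_
    have h1 := I.sub_mem (I.mul_mem_right _ (y α v) h)
      (I.mul_mem_left (ofBase α v a * x α v ^ j) _ (x_mul_y_sub_mem I hI))
    convert h1 using 1
    rw [map_mul, mul_assoc, ← x_pow_mul_ofBase, pow_succ]
    noncomm_ring

/-- The ideal of all `a ∈ A` with `a yⁿ ∈ I` for some `n`. -/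
def yCoeffIdeal : TwoSidedIdeal A :=
  have hn : ∀ {n a} k, ofBase α v a * y α v ^ n ∈ I → ofBase α v a * y α v ^ (n + k) ∈ I := by
    intro n a k h
    rw [pow_add, ← mul_assoc]
    exact I.mul_mem_right _ _ h
  TwoSidedIdeal.mk' {a | ∃ n, ofBase α v a * y α v ^ n ∈ I} ⟨0, by simp [I.zero_mem]⟩
    (by
      rintro a b ⟨n, hna⟩ ⟨k, hk⟩
      refine ⟨n + k, ?_⟩
      rw [map_add, add_mul]
      exact I.add_mem (hn k hna) (add_comm k n ▸ hn n hk))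
    (by
      rintro a ⟨n, h⟩
      exact ⟨n, by rw [map_neg, neg_mul]; exact I.neg_mem h⟩)
    (by
      rintro a b ⟨n, h⟩
      exact ⟨n, by rw [map_mul, mul_assoc]; exact I.mul_mem_left _ _ h⟩)
    (by
      rintro a b ⟨n, h⟩
      refine ⟨n, ?_⟩
      -- Moving a coefficient left past yⁿ applies αⁿ, so the multiplier is pre-twisted by the
      -- inverse.
      have := I.mul_mem_right _ (ofBase α v ((α ^ n).symm b)) h
      rwa [mul_assoc, y_pow_mul_ofBase, AlgEquiv.apply_symm_apply, ← mul_assoc, ← map_mul] at this)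

theorem mem_yCoeffIdeal {a : A} : a ∈ yCoeffIdeal I ↔ ∃ n, ofBase α v a * y α v ^ n ∈ I := by
  rw [yCoeffIdeal, TwoSidedIdeal.mem_mk']; rfl

theorem apply_mem_yCoeffIdeal {a : A} (h : a ∈ yCoeffIdeal I) : α a ∈ yCoeffIdeal I := by
  obtain ⟨n, hn⟩ := (mem_yCoeffIdeal I).1 h
  refine (mem_yCoeffIdeal I).2 ⟨n + 1, ?_⟩
  have := I.mul_mem_left (y α v) _ hn
  rwa [← mul_assoc, y_mul_ofBase, mul_assoc, ← pow_succ'] at this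

/-- Multiplying y^{n+1} by x on the left gives w yⁿ, and on the right α^{n+1}(w) yⁿ. Comaximality of
the two coefficients puts yⁿ in I, and n descends to 0. -/
theorem one_mem_of_y_pow_mem (hv : (v : A) = u - α u)
    (hI : casimir α v u - ofBase α v (algebraMap K A lam) ∈ I)
    (hm : ∀ m, 1 ≤ m → ∃ a b : A,
      (u + algebraMap K A lam) * a + (α ^ m) (u + algebraMap K A lam) * b = 1)
    (n : ℕ) (hn : y α v ^ n ∈ I) : (1 : AmbiskewAlgebra α v) ∈ I := by
  induction n with
  | zero => simpa using hn
  | succ n ih =>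
    apply ih
    have hc : ∀ (j : ℕ) (b : A), (α ^ j) (u + algebraMap K A lam) * b
        = b * (α ^ j) (u + algebraMap K A lam) := fun j b =>
      (Subalgebra.mem_center_iff.1 (apply_mem_center (α ^ j)
        (add_mem u.2 (Subalgebra.algebraMap_mem _ lam))) b).symm
    have h1 : ofBase α v (u + algebraMap K A lam) * y α v ^ n ∈ I := by
      convert I.sub_mem (I.mul_mem_left (x α v) _ hn)
        (I.mul_mem_right _ (y α v ^ n) (x_mul_y_sub_mem I hI)) using 1
      rw [pow_succ']; noncomm_ring
    have h2 : ofBase α v ((α ^ (n + 1)) (u + algebraMap K A lam)) * y α v ^ n ∈ I := by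
      convert I.sub_mem (I.mul_mem_right _ (x α v) hn)
        (I.mul_mem_left (y α v ^ n) _ (y_mul_x_sub_mem I hv hI)) using 1
      rw [mul_sub, y_pow_mul_ofBase, pow_succ (y α v)]
      simp only [mul_assoc]
      abel
    obtain ⟨a, b, hab⟩ := hm (n + 1) (by omega)
    have h3 := I.add_mem (I.mul_mem_left (ofBase α v a) _ h1) (I.mul_mem_left (ofBase α v b) _ h2)
    have hc0 := hc 0 a
    rw [pow_zero, AlgEquiv.one_apply] at hc0
    rwa [← mul_assoc, ← mul_assoc, ← map_mul, ← map_mul, ← add_mul, ← map_add, ← hc, ← hc0, hab,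
      map_one, one_mul] at h3

end

/-- The monomials `b yⁱ xʲ` are eigenvectors for conjugation by a central `g ∈ A` with
`α(g⁻¹) = c g⁻¹`. -/
theorem conj_monomial {g h : A} (hg : ∀ a, g * a = a * g) (hgh : g * h = 1) {c : Kˣ}
    (hαh : α h = (c : K) • h) (b : A) (i j : ℕ) :
    ofBase α v g * ((ofBase α v b * y α v ^ i * x α v ^ j) * ofBase α v h)
      = ofBase α v (algebraMap K A ((c ^ ((i : ℤ) - j) : Kˣ) : K))
        * (ofBase α v b * y α v ^ i * x α v ^ j) := by
  have hαi : ∀ i : ℕ, (α ^ i) h = ((c : K) ^ i) • h := fun i => by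
    induction i with
    | zero => simp
    | succ i ih =>
      rw [pow_succ', AlgEquiv.mul_apply, ih, map_smul, hαh, smul_smul, pow_succ]
  have hαs : α.symm h = (c⁻¹ : K) • h := by
    rw [AlgEquiv.symm_apply_eq, map_smul, hαh, smul_smul, inv_mul_cancel₀ c.ne_zero, one_smul]
  have hαj : ∀ j : ℕ, (α.symm ^ j) h = ((c⁻¹ : K) ^ j) • h := fun j => by
    induction j with
    | zero => simp
    | succ j ih =>
      rw [pow_succ', AlgEquiv.mul_apply, ih, map_smul, hαs, smul_smul, pow_succ]
  have hcij : ((c ^ ((i : ℤ) - j) : Kˣ) : K) = (c⁻¹ : K) ^ j * (c : K) ^ i := by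
    rw [zpow_sub, zpow_natCast, zpow_natCast, mul_comm, Units.val_mul, ← inv_pow, Units.val_pow_eq_pow_val,
      Units.val_pow_eq_pow_val, Units.val_inv_eq_inv_val]
  have hb : g * (b * ((α ^ i) ((α.symm ^ j) h)))
      = algebraMap K A ((c ^ ((i : ℤ) - j) : Kˣ) : K) * b := by
    rw [hαj, map_smul, hαi, smul_smul, mul_smul_comm, mul_smul_comm, ← mul_assoc, hg, mul_assoc,
      hgh, mul_one, Algebra.smul_def, hcij]
  rw [mul_assoc (_ * _) (x α v ^ j), x_pow_mul_ofBase, mul_assoc (ofBase α v b),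
    ← mul_assoc (y α v ^ i), y_pow_mul_ofBase, mul_assoc (ofBase α v _) (y α v ^ i),
    ← mul_assoc (ofBase α v b), ← mul_assoc (ofBase α v g), ← map_mul, ← map_mul, hb, map_mul]
  simp only [mul_assoc]

/-- The terms of a sum in an ideal belong to the ideal. -/
theorem term_mem_of_sum_mem (I : TwoSidedIdeal (AmbiskewAlgebra α v)) {g h : A}
    (hg : ∀ a, g * a = a * g) (hgh : g * h = 1) {c : Kˣ} (hc : ∀ n : ℤ, c ^ n = 1 → n = 0)
    (hαh : α h = (c : K) • h) (a : ℤ →₀ A)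
    (hsum : a.sum (fun n b => ofBase α v b * y α v ^ n.toNat * x α v ^ (-n).toNat) ∈ I) (n : ℤ)
    (hn : n ∈ a.support) :
    ofBase α v (a n) * y α v ^ n.toNat * x α v ^ (-n).toNat ∈ I := by
  -- As h is inverse to g, D is conjugation by g. The term of index n has eigenvalue cⁿ, and these
  -- are distinct because c has infinite order.
  let D : AmbiskewAlgebra α v →+ AmbiskewAlgebra α v :=
    (AddMonoidHom.mulLeft (ofBase α v g)).comp (AddMonoidHom.mulRight (ofBase α v h))
  have hD : ∀ f, D f = ofBase α v g * (f * ofBase α v h) := fun _ => rfl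
  have hDI : ∀ f ∈ I, D f ∈ I := fun f hf => by
    rw [hD]
    exact I.mul_mem_left _ _ (I.mul_mem_right _ _ hf)
  have hDφ : ∀ (b : K) f, D ((ofBase α v).comp (algebraMap K A) b * f)
      = (ofBase α v).comp (algebraMap K A) b * D f := fun b f => by
    rw [hD, hD, RingHom.comp_apply, mul_assoc, ← mul_assoc, ← ofBase_algebraMap_mul, mul_assoc]
  have hDm : ∀ n : ℤ, D (ofBase α v (a n) * y α v ^ n.toNat * x α v ^ (-n).toNat)
      = (ofBase α v).comp (algebraMap K A) ((c ^ n : Kˣ) : K)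
        * (ofBase α v (a n) * y α v ^ n.toNat * x α v ^ (-n).toNat) := fun n => by
    have : (n.toNat : ℤ) - ((-n).toNat : ℤ) = n := by omega
    rw [hD, conj_monomial hg hgh hαh, this, RingHom.comp_apply]
  refine mem_of_sum_mem ((ofBase α v).comp (algebraMap K A)) I a.support
    (fun n => ofBase α v (a n) * y α v ^ n.toNat * x α v ^ (-n).toNat) ?_ hsum n hn
  intro i _ j _ hij
  refine ⟨D, hDI, hDφ, fun n => ((c ^ n : Kˣ) : K), fun n _ => hDm n, fun he => hij ?_⟩
  have he' : c ^ i = c ^ j := Units.ext he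
  exact sub_eq_zero.1 (hc _ (by rw [zpow_sub, he', mul_inv_cancel]))

/-- A simplicity criterion for `R / (z - λ) R`. -/
theorem isCoatom_centralIdeal_casimir [Nontrivial A] [NoZeroDivisors A] (hv : (v : A) = u - α u)
    (hα : ∀ I : TwoSidedIdeal A, (∀ a ∈ I, α a ∈ I) → ∀ a ∈ I, a ≠ 0 → (1 : A) ∈ I)
    {g h : A} (hg : ∀ a, g * a = a * g) (hgh : g * h = 1) {c : Kˣ} (hc : ∀ n : ℤ, c ^ n = 1 → n = 0)
    (hαh : α h = (c : K) • h) (hu : (u + algebraMap K A lam : A) ≠ 0)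
    (hm : ∀ m, 1 ≤ m → ∃ a b : A,
      (u + algebraMap K A lam) * a + (α ^ m) (u + algebraMap K A lam) * b = 1) :
    IsCoatom (centralIdeal _ (casimir_sub_mem_center α v u hv lam)) := by
  refine ⟨centralIdeal_casimir_ne_top hv, fun I hlt => ?_⟩
  have hI : casimir α v u - ofBase α v (algebraMap K A lam) ∈ I :=
    hlt.le (self_mem_centralIdeal _)
  obtain ⟨f, hfI, hf⟩ := SetLike.exists_of_lt hlt
  obtain ⟨a, ha⟩ := exists_sub_sum_mem _ hv (self_mem_centralIdeal
    (casimir_sub_mem_center α v u hv lam)) f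
  have hsum := I.sub_mem hfI (hlt.le ha)
  rw [sub_sub_cancel] at hsum
  have hmem := term_mem_of_sum_mem I hg hgh hc hαh a hsum
  have hne : a ≠ 0 := by
    rintro rfl
    exact hf (by simpa using ha)
  obtain ⟨n, hn⟩ := Finsupp.support_nonempty_iff.2 hne
  have hn' := hmem n hn
  rw [Finsupp.mem_support_iff] at hn
  -- A term a yⁿ supplies its own coefficient; for a term a xⁿ the powers of x are first traded for
  -- factors in A.
  have h1 : ∃ b, b ≠ 0 ∧ b ∈ yCoeffIdeal I := by
    rcases le_total 0 n with h0 | h0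
    · refine ⟨a n, hn, (mem_yCoeffIdeal I).2 ⟨n.toNat, ?_⟩⟩
      have : (-n).toNat = 0 := by omega
      simpa [this] using hn'
    · have : n.toNat = 0 := by omega
      obtain ⟨b, hb, hbI⟩ := exists_ofBase_mem_of_x_pow I hI hu (-n).toNat hn
        (by simpa [this] using hn')
      exact ⟨b, hb, (mem_yCoeffIdeal I).2 ⟨0, by simpa using hbI⟩⟩
  obtain ⟨b, hb, hbI⟩ := h1
  obtain ⟨k, hk⟩ := (mem_yCoeffIdeal I).1
    (hα (yCoeffIdeal I) (fun _ => apply_mem_yCoeffIdeal I) b hbI hb)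
  rw [map_one, one_mul] at hk
  exact (TwoSidedIdeal.one_mem_iff I).1 (one_mem_of_y_pow_mem I hv hI hm k hk)

end AmbiskewAlgebra

/-! ### Quantum tori are domains whose monomials are units. -/

namespace QuantumTorus

variable {K : Type*} [Field K] {ι : Type*} [LinearOrder ι] [Fintype ι] {Q : ι → ι → Kˣ}

/-- The coefficients of an element of the quantum torus on the ordered monomials. -/
def coeff (f : QuantumTorus K Q) : (ι → ℤ) →₀ K := f

theorem eq_sum_monomial (f : QuantumTorus K Q) :
    f = ∑ m ∈ (coeff f).support, monomial m (coeff f m) :=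
  (Finsupp.sum_single (coeff f)).symm

theorem coeff_ne_zero {f : QuantumTorus K Q} (hf : f ≠ 0) : (coeff f).support.Nonempty :=
  Finsupp.support_nonempty_iff.2 hf

theorem coeff_sum {κ : Type*} (s : Finset κ) (f : κ → QuantumTorus K Q) (m : ι → ℤ) :
    coeff (∑ k ∈ s, f k) m = ∑ k ∈ s, coeff (f k) m :=
  Finsupp.finsetSum_apply s f m

theorem coeff_monomial (m n : ι → ℤ) (a : K) :
    coeff (monomial m a : QuantumTorus K Q) n = if m = n then a else 0 := by
  classical
  exact (Finsupp.single_apply).trans (by congr)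

instance : Nontrivial (QuantumTorus K Q) :=
  inferInstanceAs (Nontrivial ((ι → ℤ) →₀ K))

/-- The group ℤ^ι has unique sums: for nonzero f and g some exponent arises from exactly one pair in
the supports. Its coefficient in the product is a single nonzero term. -/
instance : NoZeroDivisors (QuantumTorus K Q) where
  eq_zero_or_eq_zero_of_mul_eq_zero {f g} h := by
    by_contra! hne
    obtain ⟨m, hm, n, hn, hu⟩ :=
      UniqueSums.uniqueAdd_of_nonempty (coeff_ne_zero hne.1) (coeff_ne_zero hne.2)
    have hc : coeff (f * g) (m + n) = coeff f m * coeff g n * cocycle Q m n := by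
      conv_lhs => rw [eq_sum_monomial f, eq_sum_monomial g, Finset.sum_mul_sum]
      simp only [coeff_sum, monomial_mul_monomial, coeff_monomial]
      rw [Finset.sum_eq_single_of_mem m hm, Finset.sum_eq_single_of_mem n hn, if_pos rfl]
      · intro b hb hbn
        rw [if_neg]
        intro he
        exact hbn (hu hm hb he).2
      · intro b hb hbm
        refine Finset.sum_eq_zero fun c hc => if_neg ?_
        intro he
        exact hbm (hu hb hc he).1
    rw [h] at hc
    have h0 : (0 : K) = coeff f m * coeff g n * cocycle Q m n := hc
    exact mul_ne_zero (mul_ne_zero (Finsupp.mem_support_iff.1 hm) (Finsupp.mem_support_iff.1 hn))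
      (Units.ne_zero _) h0.symm

theorem one_mem_of_monomial_mem {I : TwoSidedIdeal (QuantumTorus K Q)} {m : ι → ℤ} {a : K}
    (ha : a ≠ 0) (h : monomial m a ∈ I) : (1 : QuantumTorus K Q) ∈ I := by
  have := I.mul_mem_left (monomial (-m) (a * cocycle Q (-m) m)⁻¹) _ h
  rw [monomial_mul_monomial, neg_add_cancel] at this
  convert this
  rw [one_def, mul_assoc, inv_mul_cancel₀ (mul_ne_zero ha (Units.ne_zero _))]

theorem algebraMap_eq (a : K) : algebraMap K (QuantumTorus K Q) a = monomial 0 a := by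
  rw [Algebra.algebraMap_eq_smul_one, one_def, ← map_smul, smul_eq_mul, mul_one]

end QuantumTorus

/-! ### Commutators in the torus A, and its α-stable ideals. -/

section Torus

open QuantumTorus

variable {K : Type*} [Field K] {p : ℕ} {q : Kˣ}

theorem zpow_neg_sum {G κ : Type*} [CommGroup G] [Fintype κ] (g : G) (f : κ → ℤ) :
    g ^ (-∑ i, f i) = ∏ i, g ^ (-f i) := by
  rw [← Finset.sum_neg_distrib]
  exact map_prod (zpowersHom G g) (fun i => Multiplicative.ofAdd (-f i)) Finset.univ

/-- The exponent of `q⁻¹` in the cocycle of the torus `A`. -/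
def torusForm (m n : Fin p → ℤ) : ℤ :=
  ∑ i, ∑ j, if j < i ∧ Odd i.val ∧ Even j.val then m i * n j else 0

/-- Indices in `Fin p` start at 0, so parities are opposite to those of the generator numbers. -/
theorem cocycle_torusMatrix (m n : Fin p → ℤ) :
    cocycle (torusMatrix p q) m n = q ^ (-torusForm m n) := by
  simp only [cocycle, torusForm, zpow_neg_sum]
  refine Finset.prod_congr rfl fun i _ => Finset.prod_congr rfl fun j _ => ?_
  have e1 : Even (i.val + 1) ↔ Odd i.val := by rw [Nat.even_add_one, Nat.not_even_iff_odd]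
  have e2 : Odd (j.val + 1) ↔ Even j.val := by rw [Nat.odd_add_one, Nat.not_odd_iff_even]
  simp only [torusMatrix, e1, e2]
  by_cases h1 : j < i <;> by_cases h2 : Odd i.val ∧ Even j.val <;> simp [h1, h2]

theorem torusForm_add_left (l m n : Fin p → ℤ) :
    torusForm (l + m) n = torusForm l n + torusForm m n := by
  simp only [torusForm, ← Finset.sum_add_distrib]
  refine Finset.sum_congr rfl fun i _ => Finset.sum_congr rfl fun j _ => ?_
  split_ifs <;> simp [add_mul]

theorem torusForm_neg_right (m n : Fin p → ℤ) : torusForm m (-n) = -torusForm m n := by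
  simp only [torusForm, ← Finset.sum_neg_distrib]
  refine Finset.sum_congr rfl fun i _ => Finset.sum_congr rfl fun j _ => ?_
  split_ifs <;> simp

theorem torusForm_single_left (i : Fin p) (n : Fin p → ℤ) :
    torusForm (Pi.single i 1) n = ∑ j, if j < i ∧ Odd i.val ∧ Even j.val then n j else 0 := by
  rw [torusForm, Finset.sum_eq_single i]
  · simp
  · intro b _ hb
    simp [Pi.single_eq_of_ne hb]
  · simp

theorem torusForm_single_right (i : Fin p) (m : Fin p → ℤ) :
    torusForm m (Pi.single i 1) = ∑ a, if i < a ∧ Odd a.val ∧ Even i.val then m a else 0 := by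
  rw [torusForm]
  refine Finset.sum_congr rfl fun a _ => ?_
  rw [Finset.sum_eq_single i]
  · simp
  · intro b _ hb
    simp [Pi.single_eq_of_ne hb]
  · simp

theorem sum_eq_imp_eq {κ : Type*} [Fintype κ] {f g : κ → ℤ} (k : κ) (h : ∑ i, f i = ∑ i, g i)
    (hne : ∀ i, i ≠ k → f i = g i) : f k = g k := by
  classical
  rw [← Finset.add_sum_erase _ f (Finset.mem_univ k), ← Finset.add_sum_erase _ g (Finset.mem_univ k),
    Finset.sum_congr rfl fun i hi => hne i (Finset.ne_of_mem_erase hi)] at h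
  exact add_right_cancel h

/-- The commutator exponents with the generators determine all coordinates of an exponent vector
but the last one. -/
theorem eq_of_torusForm_eq (hp : Odd p) {k l : Fin p → ℤ}
    (h : ∀ i, torusForm k (Pi.single i 1) - torusForm (Pi.single i 1) k
      = torusForm l (Pi.single i 1) - torusForm (Pi.single i 1) l) (j : Fin p)
    (hj : j ≠ lastIndex hp) : k j = l j := by
  have hjp : j.val + 1 < p := by
    have h1 := j.2
    have h2 : j.val ≠ p - 1 := fun h => hj (Fin.ext h)
    omega
  simp only [torusForm_single_left, torusForm_single_right] at h
  -- The commutator with the generator of odd index j + 1 sums the even coordinates up to j, so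
  -- these are recovered in increasing order. The condition j + 1 < p leaves out the last index.
  have heven : ∀ n (j : Fin p), j.val = n → j.val + 1 < p → Even j.val → k j = l j := by
    intro n
    induction n using Nat.strong_induction_on with
    | _ n ih =>
      intro j hn hjp hje
      have hi := h ⟨j.val + 1, hjp⟩
      have ho : ¬ Even (j.val + 1) := by rw [Nat.even_add_one]; simpa using hje
      have ho' : Odd (j.val + 1) := Nat.not_even_iff_odd.1 ho
      simp only [ho, ho', and_false, true_and, if_false, Finset.sum_const_zero, zero_sub,
        neg_inj] at hi
      have := sum_eq_imp_eq j hi fun b hb => by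
        split_ifs with hc
        · have hbj : b.val < j.val := by
            have h1 := hc.1
            have h2 : b.val ≠ j.val := fun h => hb (Fin.ext h)
            rw [Fin.lt_def] at h1
            simp only at h1
            omega
          exact ih b.val (hn ▸ hbj) b rfl (by omega) hc.2
        · rfl
      rwa [if_pos, if_pos] at this
      all_goals exact ⟨Fin.lt_def.2 (Nat.lt_succ_self _), hje⟩
  -- The commutator with the generator of even index j - 1 sums the odd coordinates from j on, so
  -- these are recovered in decreasing order.
  have hodd : ∀ n (j : Fin p), p - j.val = n → Odd j.val → k j = l j := by
    intro n
    induction n using Nat.strong_induction_on with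
    | _ n ih =>
      intro j hn hjo
      have hj0 : 0 < j.val := hjo.pos
      have hi := h ⟨j.val - 1, by omega⟩
      have he : Even (j.val - 1) := Nat.Odd.sub_odd hjo odd_one
      have he' : ¬ Odd (j.val - 1) := Nat.not_odd_iff_even.2 he
      simp only [he, he', and_false, false_and, and_true, if_false, Finset.sum_const_zero,
        sub_zero] at hi
      have := sum_eq_imp_eq j hi fun b hb => by
        split_ifs with hc
        · have hbj : j.val < b.val := by
            have h1 := hc.1
            have h2 : b.val ≠ j.val := fun h => hb (Fin.ext h)
            rw [Fin.lt_def] at h1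
            simp only at h1
            omega
          exact ih (p - b.val) (by have := b.2; omega) b rfl hc.2
        · rfl
      rwa [if_pos, if_pos] at this
      all_goals exact ⟨Fin.lt_def.2 (by simp only; omega), hjo⟩
  rcases Nat.even_or_odd j.val with he | ho
  · exact heven _ j rfl hjp he
  · exact hodd _ j rfl ho

theorem zpow_injective_of_pow_ne_one {G : Type*} [Group G] {g : G}
    (hg : ∀ n : ℕ, 1 ≤ n → g ^ n ≠ 1) : Function.Injective fun n : ℤ => g ^ n := by
  refine injective_zpow_iff_not_isOfFinOrder.2 fun h => ?_
  obtain ⟨n, hn, h1⟩ := isOfFinOrder_iff_pow_eq_one.1 h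
  exact hg n hn h1

/-- The ordered monomial z^{-e} inverts z^e only up to a scalar, whence the summand `torusForm e e`.
It does not depend on k and so does not affect the separation of eigenvalues. -/
theorem conj_torus_monomial (e k : Fin p → ℤ) (a : K) :
    (monomial e 1 * (monomial k a * monomial (-e) 1) : TorusA p q)
      = algebraMap K _ ((q ^ (torusForm k e - torusForm e k + torusForm e e) : Kˣ) : K)
        * monomial k a := by
  rw [← mul_assoc, monomial_mul_monomial, monomial_mul_monomial, algebraMap_eq,
    monomial_mul_monomial, cocycle_torusMatrix, cocycle_torusMatrix, cocycle_zero_left,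
    torusForm_neg_right, torusForm_add_left, zero_add, add_neg_cancel_comm]
  congr 1
  have : torusForm k e - torusForm e k + torusForm e e
    = -torusForm e k + - -(torusForm e e + torusForm k e) := by ring
  rw [this, zpow_add]
  push_cast
  ring

/-- Conjugation by a suitable generator works, since the commutator exponents detect every
coordinate except that of the central z_p. Being inner up to a scalar, it preserves every ideal. -/
theorem exists_conj_separating (hp : Odd p) (hq : ∀ n : ℕ, 1 ≤ n → q ^ n ≠ 1)
    (a : (Fin p → ℤ) → K) {k l : Fin p → ℤ} (hkl : ∃ j, j ≠ lastIndex hp ∧ k j ≠ l j) :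
    ∃ D : TorusA p q →+ TorusA p q, (∀ I : TwoSidedIdeal (TorusA p q), ∀ x ∈ I, D x ∈ I) ∧
      (∀ c x, D (algebraMap K _ c * x) = algebraMap K _ c * D x) ∧
      ∃ χ : (Fin p → ℤ) → K,
        (∀ m, D (monomial m (a m)) = algebraMap K _ (χ m) * monomial m (a m)) ∧ χ k ≠ χ l := by
  have : ∃ i, torusForm k (Pi.single i 1) - torusForm (Pi.single i 1) k
      ≠ torusForm l (Pi.single i 1) - torusForm (Pi.single i 1) l := by
    by_contra! h
    obtain ⟨j, hj, hne⟩ := hkl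
    exact hne (eq_of_torusForm_eq hp h j hj)
  obtain ⟨i, hi⟩ := this
  refine ⟨(AddMonoidHom.mulLeft (monomial (Pi.single i 1) 1)).comp
    (AddMonoidHom.mulRight (monomial (-Pi.single i 1) 1)), fun I x hx => ?_, fun c x => ?_,
    fun m => _, fun m => conj_torus_monomial _ m (a m), fun h => hi ?_⟩
  · exact I.mul_mem_left _ _ (I.mul_mem_right _ _ hx)
  · change _ * ((_ * x) * _) = _ * (_ * (x * _))
    rw [mul_assoc, ← mul_assoc, ← Algebra.commutes, mul_assoc]
  · have := zpow_injective_of_pow_ne_one hq (Units.ext h)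
    exact add_right_cancel this

theorem torusAlpha_monomial (k : Fin p → ℤ) (a : K) :
    torusAlpha p q (monomial k a) = algebraMap K _
      ((q ^ (-∑ i, if Odd i.val then 0 else k i) : Kˣ) : K) * monomial k a := by
  rw [torusAlpha, scale_monomial, ← Algebra.smul_def]
  congr 2
  rw [character, zpow_neg_sum]
  refine Finset.prod_congr rfl fun i _ => ?_
  have e1 : Even (i.val + 1) ↔ Odd i.val := by rw [Nat.even_add_one, Nat.not_even_iff_odd]
  simp only [e1]
  split_ifs <;> simp

/-- The torus `A` has no nontrivial `α`-stable ideals. -/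
theorem one_mem_of_torusAlpha_stable (hp : Odd p) (hq : ∀ n : ℕ, 1 ≤ n → q ^ n ≠ 1)
    (I : TwoSidedIdeal (TorusA p q)) (hI : ∀ a ∈ I, torusAlpha p q a ∈ I) (f : TorusA p q)
    (hf : f ∈ I) (hf0 : f ≠ 0) : (1 : TorusA p q) ∈ I := by
  obtain ⟨m, hm⟩ := coeff_ne_zero hf0
  refine one_mem_of_monomial_mem (Finsupp.mem_support_iff.1 hm)
    (mem_of_sum_mem (algebraMap K _) I (coeff f).support (fun m => monomial m (coeff f m)) ?_
    (by rwa [← eq_sum_monomial]) m hm)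
  intro k _ l _ hkl
  -- Conjugations cannot separate exponents that differ only at the central z_p. For these α does,
  -- as it scales z_p by q⁻¹.
  by_cases h : ∃ j, j ≠ lastIndex hp ∧ k j ≠ l j
  · obtain ⟨D, h1, h2, χ, h3, h4⟩ := exists_conj_separating hp hq (coeff f) h
    exact ⟨D, h1 I, h2, χ, fun k _ => h3 k, h4⟩
  · push Not at h
    refine ⟨(torusAlpha p q : TorusA p q →+* TorusA p q).toAddMonoidHom, hI, fun c x => ?_,
      fun m => _, fun m _ => torusAlpha_monomial m _, fun he => hkl ?_⟩
    · change torusAlpha p q (_ * x) = _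
      rw [map_mul, AlgEquiv.commutes]; rfl
    · have h1 := neg_injective (zpow_injective_of_pow_ne_one hq (Units.ext he))
      have h2 := sum_eq_imp_eq (lastIndex hp) h1 fun i hi => by rw [h i hi]
      have h3 : ¬ Odd (lastIndex hp).val := by
        rw [Nat.not_odd_iff_even]; exact Nat.Odd.sub_odd hp odd_one
      rw [if_neg h3, if_neg h3] at h2
      funext i
      by_cases hi : i = lastIndex hp
      · rw [hi, h2]
      · exact h i hi

/-! ### Specialization of the central generator z_p. -/

theorem not_odd_lastIndex (hp : Odd p) : ¬ Odd (lastIndex hp).val := by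
  rw [Nat.not_odd_iff_even]; exact Nat.Odd.sub_odd hp odd_one

/-- The last index is even and is below no other index, so its coordinate enters neither argument of
the form. This is the centrality of z_p. -/
theorem torusForm_congr (hp : Odd p) {m m' n n' : Fin p → ℤ}
    (hm : ∀ i, i ≠ lastIndex hp → m i = m' i) (hn : ∀ i, i ≠ lastIndex hp → n i = n' i) :
    torusForm m n = torusForm m' n' := by
  refine Finset.sum_congr rfl fun i _ => Finset.sum_congr rfl fun j _ => ?_
  split_ifs with h
  · rw [hm i, hn j]
    · rintro rfl
      have h1 := Fin.lt_def.1 h.1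
      have h2 := i.2
      simp only [lastIndex] at h1
      omega
    · rintro rfl
      exact not_odd_lastIndex hp h.2.1
  · rfl

theorem cocycle_single_last_left (hp : Odd p) (k : ℤ) (n : Fin p → ℤ) :
    cocycle (torusMatrix p q) (Pi.single (lastIndex hp) k) n = 1 := by
  rw [cocycle_torusMatrix, torusForm_congr hp (m' := 0) (n' := n) (fun i hi => by simp [hi])
    (fun _ _ => rfl), ← cocycle_torusMatrix, cocycle_zero_left]

theorem genPow_last_mul_monomial (hp : Odd p) (k : ℤ) (n : Fin p → ℤ) (a : K) :
    (genPow (lastIndex hp) k * monomial n a : TorusA p q)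
      = monomial (Pi.single (lastIndex hp) k + n) a := by
  rw [genPow, monomial_mul_monomial, cocycle_single_last_left]; simp

theorem genPow_last_mul (hp : Odd p) (k l : ℤ) :
    (genPow (lastIndex hp) k * genPow (lastIndex hp) l : TorusA p q)
      = genPow (lastIndex hp) (k + l) := by
  rw [genPow.eq_1 _ l, genPow_last_mul_monomial, ← Pi.single_add]; rfl

theorem genPow_last_zero (hp : Odd p) : (genPow (lastIndex hp) 0 : TorusA p q) = 1 := by
  rw [genPow, Pi.single_zero, one_def]

theorem update_last_add (hp : Odd p) (m n : Fin p → ℤ) :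
    Function.update (m + n) (lastIndex hp) 0
      = Function.update m (lastIndex hp) 0 + Function.update n (lastIndex hp) 0 := by
  funext i
  by_cases hi : i = lastIndex hp
  · subst hi; simp
  · simp [hi]

/-- The endomorphism of `A` which specializes the central generator `z_p` to the scalar `t`. -/
noncomputable def specialize (hp : Odd p) (q t : Kˣ) : TorusA p q →ₐ[K] TorusA p q :=
  AlgHom.ofLinearMap
    (lift fun n => ((t ^ n (lastIndex hp) : Kˣ) : K) • monomial (Function.update n (lastIndex hp) 0))
    (by
      rw [one_def, lift_monomial]
      simp)
    (by
      intro f g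
      let F : TorusA p q →ₗ[K] TorusA p q := lift fun n =>
        ((t ^ n (lastIndex hp) : Kˣ) : K) • monomial (Function.update n (lastIndex hp) 0)
      have hF : ∀ n a, F (monomial n a) = ((t ^ n (lastIndex hp) : Kˣ) : K) •
        monomial (Function.update n (lastIndex hp) 0) a := fun n a => lift_monomial _ n a
      change mulHom.compr₂ F f g = (mulHom.comp F).compl₂ F f g
      refine LinearMap.congr_fun (LinearMap.congr_fun ?_ f) g
      refine hom_ext fun m => hom_ext fun n => ?_
      have hc : cocycle (torusMatrix p q) (Function.update m (lastIndex hp) 0)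
          (Function.update n (lastIndex hp) 0) = cocycle (torusMatrix p q) m n := by
        rw [cocycle_torusMatrix, cocycle_torusMatrix, torusForm_congr hp]
        · intro i hi; simp [hi]
        · intro i hi; simp [hi]
      simp only [LinearMap.compr₂_apply, LinearMap.compl₂_apply, LinearMap.comp_apply, hF,
        mulHom_monomial, map_smul, LinearMap.smul_apply, smul_smul, update_last_add, hc,
        Pi.add_apply, zpow_add]
      push_cast
      rw [mul_comm])

theorem specialize_monomial (hp : Odd p) (q t : Kˣ) (n : Fin p → ℤ) (a : K) :
    specialize hp q t (monomial n a) = ((t ^ n (lastIndex hp) : Kˣ) : K) •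
      monomial (Function.update n (lastIndex hp) 0) a :=
  lift_monomial _ n a

theorem specialize_genPow (hp : Odd p) (q t : Kˣ) (k : ℤ) :
    specialize hp q t (genPow (lastIndex hp) k) = algebraMap K _ ((t ^ k : Kˣ) : K) := by
  have : Function.update (Pi.single (lastIndex hp) k : Fin p → ℤ) (lastIndex hp) 0 = 0 := by
    funext i
    by_cases hi : i = lastIndex hp
    · subst hi; simp
    · simp [hi]
  rw [genPow, specialize_monomial, this, Pi.single_eq_same, Algebra.algebraMap_eq_smul_one, one_def]

/-- Modulo z_p - t the power z_p^k becomes t^k; negative k are reached because z_p is invertible. -/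
theorem genPow_sub_mem (hp : Odd p) {I : TwoSidedIdeal (TorusA p q)} {t : Kˣ}
    (hI : genPow (lastIndex hp) 1 - algebraMap K _ (t : K) ∈ I) (k : ℤ) :
    genPow (lastIndex hp) k - algebraMap K _ ((t ^ k : Kˣ) : K) ∈ I := by
  have hs : ∀ k : ℤ, (genPow (lastIndex hp) (k + 1) : TorusA p q)
      - algebraMap K _ ((t ^ (k + 1) : Kˣ) : K)
      = (genPow (lastIndex hp) k - algebraMap K _ ((t ^ k : Kˣ) : K)) * genPow (lastIndex hp) 1
        + algebraMap K _ ((t ^ k : Kˣ) : K)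
          * (genPow (lastIndex hp) 1 - algebraMap K _ (t : K)) := by
    intro k
    rw [← genPow_last_mul, zpow_add_one, Units.val_mul, map_mul]
    noncomm_ring
  induction k using Int.induction_on with
  | zero => simp [genPow_last_zero, I.zero_mem]
  | succ k ih =>
    rw [hs]
    exact I.add_mem (I.mul_mem_right _ _ ih) (I.mul_mem_left _ _ hI)
  | pred k ih =>
    have h1 := hs (-k - 1)
    rw [sub_add_cancel] at h1
    have h2 := I.sub_mem ih (I.mul_mem_left (algebraMap K _ ((t ^ (-k - 1 : ℤ) : Kˣ) : K)) _ hI)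
    rw [h1, add_sub_cancel_right] at h2
    have h3 := I.mul_mem_right _ (genPow (lastIndex hp) (-1)) h2
    rwa [mul_assoc, genPow_last_mul, add_neg_cancel, genPow_last_zero, mul_one] at h3

theorem sub_specialize_mem (hp : Odd p) {I : TwoSidedIdeal (TorusA p q)} {t : Kˣ}
    (hI : genPow (lastIndex hp) 1 - algebraMap K _ (t : K) ∈ I) (f : TorusA p q) :
    f - specialize hp q t f ∈ I := by
  rw [eq_sum_monomial f, map_sum, ← Finset.sum_sub_distrib]
  refine I.finsetSum_mem _ _ fun n _ => ?_
  have : (monomial n (coeff f n) : TorusA p q) = genPow (lastIndex hp) (n (lastIndex hp))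
      * monomial (Function.update n (lastIndex hp) 0) (coeff f n) := by
    rw [genPow_last_mul_monomial]
    congr 2
    funext i
    by_cases hi : i = lastIndex hp
    · subst hi; simp
    · simp [hi]
  rw [specialize_monomial, Algebra.smul_def]
  nth_rewrite 1 [this]
  rw [← sub_mul]
  exact I.mul_mem_right _ _ (genPow_sub_mem hp hI _)

/-- I is the kernel of an endomorphism of a domain, hence completely prime. For maximality, a larger
ideal J contains a nonzero element of the image. Its exponents vanish at the last coordinate, so
conjugations separate them all and J contains a monomial, which is a unit. -/
theorem isCoatom_of_mem_iff (hp : Odd p) (hq : ∀ n : ℕ, 1 ≤ n → q ^ n ≠ 1)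
    {I : TwoSidedIdeal (TorusA p q)} {t : Kˣ} (hI : ∀ f, f ∈ I ↔ specialize hp q t f = 0) :
    IsCoatom I ∧ IsCompletelyPrime I := by
  have hne : I ≠ ⊤ := fun h => by
    have := (hI 1).1 ((TwoSidedIdeal.one_mem_iff I).2 h)
    rw [map_one] at this
    exact one_ne_zero this
  refine ⟨⟨hne, fun J hJ => ?_⟩, hne, fun a b hab => ?_⟩
  · obtain ⟨f, hfJ, hf⟩ := SetLike.exists_of_lt hJ
    rw [hI] at hf
    have ht : genPow (lastIndex hp) 1 - algebraMap K _ (t : K) ∈ J := by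
      apply hJ.le
      rw [hI, map_sub, specialize_genPow, AlgHom.commutes, zpow_one, sub_self]
    have hg : specialize hp q t f ∈ J := by
      have := J.sub_mem hfJ (sub_specialize_mem hp ht f)
      rwa [sub_sub_cancel] at this
    obtain ⟨m, hm⟩ := coeff_ne_zero hf
    have hlast : ∀ n ∈ (coeff (specialize hp q t f)).support, n (lastIndex hp) = 0 := by
      intro n hn
      by_contra h0
      refine Finsupp.mem_support_iff.1 hn ?_
      rw [eq_sum_monomial f, map_sum, coeff_sum]
      refine Finset.sum_eq_zero fun k _ => ?_
      rw [specialize_monomial, ← map_smul, coeff_monomial, if_neg]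
      rintro rfl
      simp at h0
    refine (TwoSidedIdeal.one_mem_iff J).1 (one_mem_of_monomial_mem (Finsupp.mem_support_iff.1 hm)
      (mem_of_sum_mem (algebraMap K _) J _ (fun m => monomial m (coeff (specialize hp q t f) m)) ?_
      (by rwa [← eq_sum_monomial]) m hm))
    intro k hk l hl hkl
    have : ∃ j, j ≠ lastIndex hp ∧ k j ≠ l j := by
      by_contra! h
      refine hkl (funext fun i => ?_)
      by_cases hi : i = lastIndex hp
      · rw [hi, hlast k hk, hlast l hl]
      · exact h i hi
    obtain ⟨D, h1, h2, χ, h3, h4⟩ := exists_conj_separating hp hq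
      (coeff (specialize hp q t f)) this
    exact ⟨D, h1 J, h2, χ, fun k _ => h3 k, h4⟩
  · rw [hI, hI, ← mul_eq_zero, ← map_mul, ← hI]
    exact hab

/-! ### The ideals generated by u + λ and α^m(u + λ). -/

theorem torusAlpha_pow_genPow (hp : Odd p) (m : ℕ) (k : ℤ) :
    (torusAlpha p q ^ m) (genPow (lastIndex hp) k : TorusA p q)
      = (((q⁻¹ ^ k) ^ m : Kˣ) : K) • genPow (lastIndex hp) k := by
  induction m with
  | zero => simp
  | succ m ih =>
    have := torusAlpha_zLastPow hp q k
    change torusAlpha p q (genPow _ k) = _ • genPow _ k at this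
    rw [pow_succ', AlgEquiv.mul_apply, ih, map_smul, this, smul_smul, pow_succ, Units.val_mul]

theorem shiftedU_eq (hp : Odd p) (lam : K) (m : ℕ) :
    shiftedU hp q lam m = ((q : K) ^ ((p - 1) / 2) * (q : K) ^ m) • genPow (lastIndex hp) (-1)
      + ((q : K) * ((q : K) ^ m)⁻¹) • genPow (lastIndex hp) 1 + algebraMap K _ lam := by
  have hu : (torusU hp q : TorusA p q) = (q : K) ^ ((p - 1) / 2) • genPow (lastIndex hp) (-1)
    + (q : K) • genPow (lastIndex hp) 1 := rfl
  rw [shiftedU, map_add (torusAlpha p q ^ m), AlgEquiv.commutes, hu, map_add, map_smul, map_smul,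
    torusAlpha_pow_genPow, torusAlpha_pow_genPow, smul_smul, smul_smul]
  simp

theorem smul_mem_twoSidedIdeal {A : Type*} [Ring A] [Algebra K A] (I : TwoSidedIdeal A) (c : K) {a : A}
    (h : a ∈ I) : c • a ∈ I := by
  rw [Algebra.smul_def]; exact I.mul_mem_left _ _ h

/-- Elimination of `z_p` from `u + λ` and `α^m(u + λ)`. -/
theorem elimination_mem (hp : Odd p) {lam : K} {m : ℕ} (hm : q ^ m ≠ 1)
    {I : TwoSidedIdeal (TorusA p q)} (h0 : shiftedU hp q lam 0 ∈ I) (h1 : shiftedU hp q lam m ∈ I) :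
    lam • genPow (lastIndex hp) 1 + ((q : K) ^ ((p - 1) / 2) * (1 + (q : K) ^ m)) • 1 ∈ I ∧
    (lam ^ 2 * ((q : K) ^ ((p - 1) / 2) * (q : K) ^ m * (q : K)⁻¹)
      - ((q : K) ^ ((p - 1) / 2) * (1 + (q : K) ^ m)) ^ 2) • (1 : TorusA p q) ∈ I := by
  have hq0 : (q : K) ≠ 0 := q.ne_zero
  have hqm : (1 : K) - (q : K) ^ m ≠ 0 := by
    rw [sub_ne_zero]
    intro h
    exact hm (Units.ext (by rw [Units.val_pow_eq_pow_val, ← h, Units.val_one]))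
  rw [shiftedU_eq] at h0 h1
  set c : K := (q : K) ^ ((p - 1) / 2)
  have e1 : (genPow (lastIndex hp) 1 * genPow (lastIndex hp) (-1) : TorusA p q) = 1 := by
    rw [genPow_last_mul, add_neg_cancel, genPow_last_zero]
  have e2 : (genPow (lastIndex hp) 1 * genPow (lastIndex hp) 1 : TorusA p q)
      = genPow (lastIndex hp) 2 := genPow_last_mul hp 1 1
  have h0' := I.mul_mem_left (genPow (lastIndex hp) 1) _ h0
  have h1' := I.mul_mem_left (genPow (lastIndex hp) 1) _ h1
  simp only [Algebra.algebraMap_eq_smul_one, mul_add, mul_smul_comm, e1, e2, mul_one, pow_zero,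
    inv_one] at h0' h1'
  -- After multiplication by z_p the two generators differ by (1 - q^m)(c - q^{1-m} z_p²). The
  -- factor used normalizes the coefficient of z_p² to 1.
  have h2 : (genPow (lastIndex hp) 2 : TorusA p q) - (c * (q : K) ^ m * (q : K)⁻¹) • 1 ∈ I := by
    convert smul_mem_twoSidedIdeal I (-(q : K) ^ m * (q : K)⁻¹ * (1 - (q : K) ^ m)⁻¹)
      (I.sub_mem h0' h1') using 1
    match_scalars <;> field_simp <;> ring
  have h3 : lam • genPow (lastIndex hp) 1 + (c * (1 + (q : K) ^ m)) • (1 : TorusA p q) ∈ I := by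
    convert I.sub_mem h0' (smul_mem_twoSidedIdeal I (q : K) h2) using 1
    match_scalars <;> field_simp <;> ring
  refine ⟨h3, ?_⟩
  -- With b = c(1 + q^m), multiplying λz_p + b by λz_p - b gives λ²z_p² - b², from which z_p² is
  -- then eliminated.
  convert I.sub_mem (I.mul_mem_left
    (lam • genPow (lastIndex hp) 1 - (c * (1 + (q : K) ^ m)) • (1 : TorusA p q)) _ h3)
    (smul_mem_twoSidedIdeal I (lam ^ 2) h2) using 1
  simp only [sub_mul, mul_add, smul_mul_smul_comm, e2, mul_one, one_mul]
  match_scalars <;> ring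

/-- After division by powers of q the equation reads λ² = q^{(p-2m+1)/2}(1 + q^m)². The fourth root
s is needed because p - 2m + 1 is even but need not be divisible by 4. -/
theorem discriminant_eq_zero_iff (hp : Odd p) {s : K} (hs : s ^ 4 = (q : K)) (lam : K) (m : ℕ) :
    lam ^ 2 * ((q : K) ^ ((p - 1) / 2) * (q : K) ^ m * (q : K)⁻¹)
      - ((q : K) ^ ((p - 1) / 2) * (1 + (q : K) ^ m)) ^ 2 = 0 ↔
    lam = s ^ ((p : ℤ) - 2 * m + 1) * ((q : K) ^ m + 1) ∨
        lam = -(s ^ ((p : ℤ) - 2 * m + 1) * ((q : K) ^ m + 1)) := by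
  have hq0 : (q : K) ≠ 0 := q.ne_zero
  have hs0 : s ≠ 0 := by rintro rfl; exact hq0 (by rw [← hs]; simp)
  obtain ⟨k, rfl⟩ := hp
  have hk : (2 * k + 1 - 1) / 2 = k := by omega
  rw [hk, ← sq_eq_sq_iff_eq_or_eq_neg]
  have hN : (s ^ (((2 * k + 1 : ℕ) : ℤ) - 2 * m + 1)) ^ 2 * (q : K) ^ m
      = (q : K) ^ k * (q : K) := by
    rw [← hs, ← pow_mul, ← pow_mul, ← pow_add, ← zpow_natCast, ← zpow_natCast, ← zpow_natCast,
      ← zpow_mul, ← zpow_add₀ hs0]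
    congr 1
    push_cast; ring
  rw [mul_pow (s ^ _)]
  set N := (s ^ (((2 * k + 1 : ℕ) : ℤ) - 2 * m + 1)) ^ 2
  have hqk : (q : K) ^ k ≠ 0 := pow_ne_zero _ hq0
  have hqm : (q : K) ^ m ≠ 0 := pow_ne_zero _ hq0
  rw [sub_eq_zero]
  constructor
  · intro h
    field_simp at h
    apply mul_right_cancel₀ hqm
    linear_combination h - (1 + (q : K) ^ m) ^ 2 * hN
  · intro h
    field_simp
    linear_combination (q : K) ^ m * h + (1 + (q : K) ^ m) ^ 2 * hN

/-- When the discriminant vanishes, the linear relation forces z_p ≡ t = -c(1 + q^m)/λ, and this t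
is a common root of the two generators. So the ideal is exactly the kernel of the specialization at
t. -/
theorem exists_mem_torusIdeal_iff (hp : Odd p) (hq : ∀ n : ℕ, 1 ≤ n → q ^ n ≠ 1) {lam : K} {m : ℕ}
    (hm : 1 ≤ m) (h : lam ^ 2 * ((q : K) ^ ((p - 1) / 2) * (q : K) ^ m * (q : K)⁻¹)
      - ((q : K) ^ ((p - 1) / 2) * (1 + (q : K) ^ m)) ^ 2 = 0) :
    ∃ t : Kˣ, ∀ f, f ∈ torusIdeal hp q lam m ↔ specialize hp q t f = 0 := by
  have hq0 : (q : K) ≠ 0 := q.ne_zero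
  have hqm : (1 : K) + (q : K) ^ m ≠ 0 := by
    intro h
    refine hq (m * 2) (by omega) (Units.ext ?_)
    rw [Units.val_pow_eq_pow_val, pow_mul, eq_neg_of_add_eq_zero_right h]
    simp
  have hmem := elimination_mem (I := torusIdeal hp q lam m) hp (hq m hm)
    (TwoSidedIdeal.mem_sup_left (self_mem_centralIdeal (shiftedU_mem_center hp q lam 0)) :
      _ ∈ torusIdeal hp q lam m)
    (TwoSidedIdeal.mem_sup_right (self_mem_centralIdeal (shiftedU_mem_center hp q lam m)))
  have hu := fun n => shiftedU_eq (q := q) hp lam n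
  set c : K := (q : K) ^ ((p - 1) / 2) with hc
  have hc0 : c ≠ 0 := pow_ne_zero _ hq0
  -- At λ = 0 the discriminant is -c²(1 + q^m)², which is nonzero because q^{2m} ≠ 1.
  have hlam : lam ≠ 0 := by
    rintro rfl
    refine mul_ne_zero hc0 hqm ?_
    simpa using h
  let t : Kˣ := Units.mk0 (-(c * (1 + (q : K) ^ m)) / lam)
    (div_ne_zero (neg_ne_zero.2 (mul_ne_zero hc0 hqm)) hlam)
  have ht : lam * (t : K) = -(c * (1 + (q : K) ^ m)) := by
    rw [Units.val_mk0, mul_div_cancel₀ _ hlam]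
  -- The vanishing discriminant says precisely that t satisfies the quadratic relation z_p² =
  -- cq^{m-1} as well as the linear one.
  have ht2 : (q : K) * (t : K) ^ 2 = c * (q : K) ^ m := by
    apply mul_left_cancel₀ (pow_ne_zero 2 hlam)
    have h' : (q : K) * (lam * (t : K)) ^ 2 = lam ^ 2 * (c * (q : K) ^ m) := by
      rw [ht]
      field_simp at h
      linear_combination -h
    linear_combination h'
  have hker : ∀ n, (c * (q : K) ^ n) * ((t⁻¹ : Kˣ) : K) + ((q : K) * ((q : K) ^ n)⁻¹) * (t : K) + lam = 0 →
      specialize hp q t (shiftedU hp q lam n) = 0 := by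
    intro n hn
    rw [hu, map_add, map_add, map_smul, map_smul, specialize_genPow, specialize_genPow,
      AlgHom.commutes, zpow_neg, zpow_one, Algebra.smul_def, Algebra.smul_def, ← map_mul, ← map_mul,
      ← map_add, ← map_add, hn, map_zero]
  have ht0 : (t : K) ≠ 0 := t.ne_zero
  have hle : torusIdeal hp q lam m ≤ TwoSidedIdeal.ker (specialize hp q t) := by
    refine sup_le (centralIdeal_le _ ?_) (centralIdeal_le _ ?_)
    · refine (TwoSidedIdeal.mem_ker _).2 (hker 0 ?_)
      rw [Units.val_inv_eq_inv_val]
      field_simp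
      linear_combination ht2 + ht
    · refine (TwoSidedIdeal.mem_ker _).2 (hker m ?_)
      rw [Units.val_inv_eq_inv_val]
      field_simp
      linear_combination ht2 + (q : K) ^ m * ht
  refine ⟨t, fun f => ⟨fun hf => (TwoSidedIdeal.mem_ker _).1 (hle hf), fun hf => ?_⟩⟩
  have h1 : genPow (lastIndex hp) 1 - algebraMap K _ (t : K) ∈ torusIdeal hp q lam m := by
    convert smul_mem_twoSidedIdeal _ lam⁻¹ hmem.1 using 1
    rw [Algebra.algebraMap_eq_smul_one, show c * (1 + (q : K) ^ m) = -(lam * t) by rw [ht, neg_neg]]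
    match_scalars <;> field_simp
  have := sub_specialize_mem hp h1 f
  rwa [hf, sub_zero] at this

theorem torusIdeal_ne_top_iff (hp : Odd p) (hq : ∀ n : ℕ, 1 ≤ n → q ^ n ≠ 1) (lam : K) {m : ℕ}
    (hm : 1 ≤ m) : torusIdeal hp q lam m ≠ ⊤ ↔
      lam ^ 2 * ((q : K) ^ ((p - 1) / 2) * (q : K) ^ m * (q : K)⁻¹)
        - ((q : K) ^ ((p - 1) / 2) * (1 + (q : K) ^ m)) ^ 2 = 0 := by
  constructor
  · intro h
    by_contra h0
    have hmem := (elimination_mem hp (hq m hm)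
      (TwoSidedIdeal.mem_sup_left (self_mem_centralIdeal (shiftedU_mem_center hp q lam 0)) :
        _ ∈ torusIdeal hp q lam m)
      (TwoSidedIdeal.mem_sup_right (self_mem_centralIdeal (shiftedU_mem_center hp q lam m)))).2
    refine h ((TwoSidedIdeal.one_mem_iff _).1 ?_)
    rw [← one_smul K (1 : TorusA p q), ← inv_mul_cancel₀ h0, mul_smul]
    exact smul_mem_twoSidedIdeal _ _ hmem
  · intro h
    obtain ⟨t, ht⟩ := exists_mem_torusIdeal_iff hp hq hm h
    exact (isCoatom_of_mem_iff hp hq ht).2.1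

/-! ### Maximality of (z - λ)R and distinctness of the critical values. -/

theorem isCoatom_casimirIdeal (hp : Odd p) (hq : ∀ n : ℕ, 1 ≤ n → q ^ n ≠ 1) {lam : K}
    (h : ∀ m, 1 ≤ m → torusIdeal hp q lam m = ⊤) : IsCoatom (casimirIdeal hp q lam) := by
  refine AmbiskewAlgebra.isCoatom_centralIdeal_casimir (torusV_eq hp q)
    (one_mem_of_torusAlpha_stable hp hq)
    (g := genPow (lastIndex hp) 1) (h := genPow (lastIndex hp) (-1)) (c := q)
    (fun a => (Subalgebra.mem_center_iff.1 (genPow_lastIndex_mem_center hp q 1) a).symm)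
    (by rw [genPow_last_mul, add_neg_cancel, genPow_last_zero])
    (fun n hn => zpow_injective_of_pow_ne_one hq (hn.trans (zpow_zero q).symm))
    (by simpa using torusAlpha_pow_genPow (q := q) hp 1 (-1)) ?_ ?_
  -- If u + λ were zero, the ideal for m = 1 would be zero rather than all of A.
  · intro h0
    have h1 : torusIdeal hp q lam 1 ≤ ⊥ := by
      refine sup_le (centralIdeal_le _ ?_) (centralIdeal_le _ ?_)
      · rw [TwoSidedIdeal.mem_bot, shiftedU, h0, map_zero]
      · rw [TwoSidedIdeal.mem_bot, shiftedU, h0, map_zero]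
    rw [h 1 le_rfl] at h1
    exact bot_ne_top (top_le_iff.1 h1)
  · intro m hm
    have h1 : (1 : TorusA p q) ∈ torusIdeal hp q lam m := (TwoSidedIdeal.one_mem_iff _).2 (h m hm)
    obtain ⟨_, ha, _, hb, hab⟩ := TwoSidedIdeal.mem_sup.1 h1
    obtain ⟨a, rfl⟩ := mem_centralIdeal.1 ha
    obtain ⟨b, rfl⟩ := mem_centralIdeal.1 hb
    exact ⟨a, b, hab⟩

/-- Specialization of z_p at the common root kills both generators, so it serves as the homomorphism
behind the truncated representation. -/
theorem not_isCoatom_casimirIdeal (hp : Odd p) (hq : ∀ n : ℕ, 1 ≤ n → q ^ n ≠ 1) {lam : K}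
    {m : ℕ} (hm : 1 ≤ m) (h : torusIdeal hp q lam m ≠ ⊤) : ¬ IsCoatom (casimirIdeal hp q lam) := by
  obtain ⟨t, ht⟩ := exists_mem_torusIdeal_iff hp hq hm ((torusIdeal_ne_top_iff hp hq lam hm).1 h)
  refine AmbiskewAlgebra.not_isCoatom_of_ringHom (torusV_eq hp q)
    (specialize hp q t : TorusA p q →+* TorusA p q) hm ?_ ?_
  · exact (ht _).1 (TwoSidedIdeal.mem_sup_left
      (self_mem_centralIdeal (shiftedU_mem_center hp q lam 0)))
  · exact (ht _).1 (TwoSidedIdeal.mem_sup_right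
      (self_mem_centralIdeal (shiftedU_mem_center hp q lam m)))

/-- Distinct indices give distinct squares of the critical values. -/
theorem eq_of_discriminant_eq_zero (hq : ∀ n : ℕ, 1 ≤ n → q ^ n ≠ 1) {lam : K} {a m : ℕ}
    (ha : 1 ≤ a) (hm : 1 ≤ m)
    (h1 : lam ^ 2 * ((q : K) ^ ((p - 1) / 2) * (q : K) ^ m * (q : K)⁻¹)
      - ((q : K) ^ ((p - 1) / 2) * (1 + (q : K) ^ m)) ^ 2 = 0)
    (h2 : lam ^ 2 * ((q : K) ^ ((p - 1) / 2) * (q : K) ^ a * (q : K)⁻¹)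
      - ((q : K) ^ ((p - 1) / 2) * (1 + (q : K) ^ a)) ^ 2 = 0) : a = m := by
  have hq0 : (q : K) ≠ 0 := q.ne_zero
  set c : K := (q : K) ^ ((p - 1) / 2)
  have hc0 : c ≠ 0 := pow_ne_zero _ hq0
  -- Eliminating λ² gives q^a(1 + q^m)² = q^m(1 + q^a)², whose two sides differ by (q^a - q^m)(1 -
  -- q^{a+m}).
  have key : c ^ 2 * (((q : K) ^ a - (q : K) ^ m) * ((q : K) ^ (a + m) - 1)) = 0 := by
    rw [pow_add]
    linear_combination (q : K) ^ a * h1 - (q : K) ^ m * h2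
  rcases mul_eq_zero.1 ((mul_eq_zero.1 key).resolve_left (pow_ne_zero 2 hc0)) with h | h
  · have : q ^ (a : ℤ) = q ^ (m : ℤ) := Units.ext (by simpa using sub_eq_zero.1 h)
    exact_mod_cast zpow_injective_of_pow_ne_one hq this
  · exact absurd (Units.ext (by simpa using sub_eq_zero.1 h)) (hq (a + m) (by omega))

end Torus
end Ambiskew
open Ambiskew in
/-- `s` is a fourth root of `q`, so that `q^{(p-2m+1)/4}` is `s^(p-2m+1)`. -/
theorem corollary3p6 {K : Type*} [Field K] [IsAlgClosed K] (p : ℕ) (hp : Odd p) (q : Kˣ)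
    (hq : ∀ n : ℕ, 1 ≤ n → q ^ n ≠ 1) (s : K) (hs : s ^ 4 = (q : K)) :
    (∀ lam : K, IsCoatom (casimirIdeal hp q lam) ↔
      ∀ m : ℕ, 1 ≤ m →
        lam ≠ s ^ ((p : ℤ) - 2 * m + 1) * ((q : K) ^ m + 1) ∧
        lam ≠ -(s ^ ((p : ℤ) - 2 * m + 1) * ((q : K) ^ m + 1))) ∧
    (∀ (lam : K) (m : ℕ), 1 ≤ m →
      (torusIdeal hp q lam m ≠ ⊤ ↔
        lam = s ^ ((p : ℤ) - 2 * m + 1) * ((q : K) ^ m + 1) ∨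
        lam = -(s ^ ((p : ℤ) - 2 * m + 1) * ((q : K) ^ m + 1)))) ∧
    (∀ (lam : K) (m : ℕ), 1 ≤ m →
      (lam = s ^ ((p : ℤ) - 2 * m + 1) * ((q : K) ^ m + 1) ∨
        lam = -(s ^ ((p : ℤ) - 2 * m + 1) * ((q : K) ^ m + 1))) →
      IsCoatom (torusIdeal hp q lam m) ∧ IsCompletelyPrime (torusIdeal hp q lam m) ∧
      ∀ a : ℕ, 1 ≤ a → a ≠ m → torusIdeal hp q lam a = ⊤) := by

  have key : ∀ (lam : K) (m : ℕ), 1 ≤ m → (torusIdeal hp q lam m ≠ ⊤ ↔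
      lam = s ^ ((p : ℤ) - 2 * m + 1) * ((q : K) ^ m + 1) ∨
        lam = -(s ^ ((p : ℤ) - 2 * m + 1) * ((q : K) ^ m + 1))) := fun lam m hm =>
    (torusIdeal_ne_top_iff hp hq lam hm).trans (discriminant_eq_zero_iff hp hs lam m)
  refine ⟨fun lam => ⟨fun h m hm => ?_, fun h => ?_⟩, key, fun lam m hm h => ?_⟩
  · rw [← not_or, ← key lam m hm]
    exact fun hne => not_isCoatom_casimirIdeal hp hq hm hne h
  · refine isCoatom_casimirIdeal hp hq fun m hm => ?_
    by_contra hne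
    exact not_or.2 (h m hm) ((key lam m hm).1 hne)
  · have hd := (discriminant_eq_zero_iff hp hs lam m).2 h
    obtain ⟨t, ht⟩ := exists_mem_torusIdeal_iff hp hq hm hd
    obtain ⟨h1, h2⟩ := isCoatom_of_mem_iff hp hq ht
    refine ⟨h1, h2, fun a ha hne => ?_⟩
    by_contra h3
    exact hne (eq_of_discriminant_eq_zero hq ha hm hd ((torusIdeal_ne_top_iff hp hq lam ha).1 h3))
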